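/- A recurrent renewal process is a random sequence $0=\tau_0<\tau_1<\tau_2<\cdots$ of integers whose gaps $\tau_{k+1}-\tau_k$ are i.i.d.; $\{n\in\tau\}$ denotes the event that $\tau_k=n$ for some $k\ge 0$, and $U_n:=\sum_{k=0}^n \mathbf P(k\in\tau)$. A measurable function $L:(0,\infty)\to(0,\infty)$ is slowly varying if $L(cx)/L(x)\to 1$ as $x\to\infty$ for every $c>0$. A sequence $(a_n)$ is regularly varying with index $\rho\in\mathbb R$ if $a_n=L(n)\,n^{\rho}$ for all large $n$, for some slowly varying $L$; it is slowly varying if this holds with $\rho=0$. (a) Let $\varphi$ be slowly varying and let $\sigma$ be a recurrent renewal process with $\mathbf P(\sigma_1=n)=\varphi(n)\,n^{-1}$ for all $n\ge 1$. Let $\tau$ be a recurrent renewal process in which $\tau_1$ equals $1$ or $2\sigma_1$ with probability $\tfrac12$ each, that is, $\mathbf P(\tau_1=1)=\tfrac12$, $\mathbf P(\tau_1=2m)=\tfrac12\mathbf P(\sigma_1=m)$ for $m\ge 1$, and $\mathbf P(\tau_1=2m-1)=0$ for $m\ge 2$. Put $r_n:=\mathbf P(\tau_1>n)$. Then $r_n\sim\tfrac12\mathbf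 P(\sigma_1>n)$, the sequence $\mathbf P(\tau_1=n)$ is not regularly varying (with any index), and $$\mathbf P(n\in\tau)\ \sim\ \frac{\varphi(n)}{2r_n^2\,n}\ \sim\ \frac{\mathbf P(\tau_1=2\lfloor n/2\rfloor)}{2\,\mathbf P(\tau_1>n)^2}\qquad (n\to\infty).$$ Moreover $\mathbf P(n\in\tau)$ is regularly varying with index $-1$ and $U_n$ is slowly varying, but the relation $\mathbf P(\tau_1=n)\sim \mathbf P(\tau_1>n)^2\,\mathbf P(n\in\tau)$ fails. (b) Consequently, it is not true that for every recurrent renewal process $\tau$ such that $\mathbf P(n\in\tau)$ is regularly varying and $U_n$ is slowly varying one has $\mathbf P(\tau_1=n)\sim\mathbf P(\tau_1>n)^2\,\mathbf P(n\in\tau)$ as $n\to\infty$. -/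

import Mathlib

open MeasureTheory ProbabilityTheory Filter Topology

/-- A positive slowly varying function on `(0, ∞)` (Karamata): measurable, positive, and
`L (c * x) / L x → 1` as `x → ∞` for every `c > 0`. Values at `x ≤ 0` are irrelevant. -/
structure SlowlyVarying (L : ℝ → ℝ) : Prop where
  measurable : Measurable L
  pos : ∀ x : ℝ, 0 < x → 0 < L x
  tendsto : ∀ c : ℝ, 0 < c → Tendsto (fun x : ℝ => L (c * x) / L x) atTop (𝓝 1)

/-- A real sequence is regularly varying with index `ρ` if, for all large `n`, its value is
`L n * n ^ ρ` with `L` a positive slowly varying function. -/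
def SeqRegularlyVaryingWithIndex (a : ℕ → ℝ) (ρ : ℝ) : Prop :=
  ∃ L : ℝ → ℝ, SlowlyVarying L ∧ ∀ᶠ n : ℕ in atTop, a n = L (n : ℝ) * (n : ℝ) ^ ρ

/-- A real sequence is regularly varying if it is so with some real index. -/
def SeqRegularlyVarying (a : ℕ → ℝ) : Prop :=
  ∃ ρ : ℝ, SeqRegularlyVaryingWithIndex a ρ

/-- A real sequence is slowly varying if it is regularly varying with index `0`. -/
def SeqSlowlyVarying (a : ℕ → ℝ) : Prop :=
  SeqRegularlyVaryingWithIndex a 0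

/-- A recurrent discrete renewal process `0 = τ 0 < τ 1 < τ 2 < ⋯`: all the renewal times are
finite, and the gaps are independent with the law of `τ 1`. The subtraction of natural numbers
in the gaps does not truncate (almost surely), because of `strictMono`. -/
structure IsRecurrentRenewal {Ω : Type*} [MeasurableSpace Ω] (P : Measure Ω)
    (τ : ℕ → Ω → ℕ) : Prop where
  measurable : ∀ k, Measurable (τ k)
  zero : ∀ᵐ ω ∂P, τ 0 ω = 0
  strictMono : ∀ᵐ ω ∂P, StrictMono (fun k => τ k ω)
  indep : iIndepFun (fun (k : ℕ) (ω : Ω) => τ (k + 1) ω - τ k ω) P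
  identDistrib : ∀ k, IdentDistrib (fun ω => τ (k + 1) ω - τ k ω) (τ 1) P P

section Renewal

variable {Ω : Type*} [MeasurableSpace Ω]

/-- The inter-arrival probabilities `P(τ₁ = n)`. -/
noncomputable def interarrival (P : Measure Ω) (τ : ℕ → Ω → ℕ) (n : ℕ) : ℝ :=
  P.real {ω | τ 1 ω = n}

/-- The tail `P(τ₁ > n)`. -/
noncomputable def interarrivalTail (P : Measure Ω) (τ : ℕ → Ω → ℕ) (n : ℕ) : ℝ :=
  P.real {ω | n < τ 1 ω}

/-- The renewal mass function `P(n ∈ τ)`, with `τ` seen as the random set of its values. -/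
noncomputable def renewalMass (P : Measure Ω) (τ : ℕ → Ω → ℕ) (n : ℕ) : ℝ :=
  P.real {ω | n ∈ Set.range (fun k => τ k ω)}

/-- The renewal function `U n = ∑_{k = 0}^n P(k ∈ τ)`. -/
noncomputable def renewalFunction (P : Measure Ω) (τ : ℕ → Ω → ℕ) (n : ℕ) : ℝ :=
  ∑ k ∈ Finset.range (n + 1), renewalMass P τ k

/-- The unaveraged reverse renewal asymptotics `P(τ₁ = n) ∼ P(τ₁ > n)² P(n ∈ τ)`. -/
def ReverseRenewalAsymptotics (P : Measure Ω) (τ : ℕ → Ω → ℕ) : Prop :=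
  Asymptotics.IsEquivalent atTop (interarrival P τ)
    (fun n : ℕ => interarrivalTail P τ n ^ 2 * renewalMass P τ n)

end Renewal

/-! Write `f`, `r`, `u` for the gap law of τ, its tail and the renewal mass, `s` for the gap law of
σ, and U for the partial sums of `u`. Differentiating the generating function identity for u = δ₀ +
f * u gives n u_n = ∑_l (u * u)_l (n - l) f_{n-l} (`RenewalSeq.mul_eq_conv`), and this sum is split
at gap length n / 2.

Long gaps: for even j > 1 the weight j f_j equals (j/2) s_{j/2}, which is close to φ(n) when j is
comparable with n; for odd j > 1 it vanishes. So the long part is about φ(n) times the mass of u * u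
on those l up to about n/2 with the parity of n. The total mass there is about U_n², since U is
slowly varying. It is shared evenly by the two parities: the alternating partial sums of u lie in
[0, 2] (`RenewalSeq.psum_alternating_mem`), so those of u * u are O(U_n) = o(U_n²). Finally U_n r_n
→ 1 (`RenewalSeq.tendsto_psum_mul_tail`), and the long part is equivalent to φ(n) / (2 r_n²).

Short gaps: if u_k = O(φ(n) / (n r_n²)) for n/4 ≤ k < n, then u * u is at most that bound times 2U_n
where needed (`LazyDouble.near_le`), and the truncated first moment of f is o(n r_n), so the short
part is negligible. The bound on u itself follows from the same estimate by strong induction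
(`LazyDouble.exists_bound`).

The gap law of τ vanishes at odd n ≥ 3 while u is eventually positive, so the reverse asymptotics
fail. The negative general statement then needs one instance, obtained from an explicit telescoping
law. -/

/-! ### Slowly varying sequences and uniform convergence. -/

/-- The filter of pairs `(p, q)` tending to infinity with `p ≤ K * q` and `q ≤ K * p`. -/
def comparablePairs (K : ℕ) : Filter (ℕ × ℕ) :=
  (atTop ×ˢ atTop) ⊓ 𝓟 {z | z.1 ≤ K * z.2 ∧ z.2 ≤ K * z.1}

/-- An eventually positive sequence whose ratios `a p / a q` tend to `1` as `p, q → ∞` with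
`p / q` bounded away from `0` and `∞`. -/
structure UnifSlow (a : ℕ → ℝ) : Prop where
  pos : ∀ᶠ n in atTop, 0 < a n
  tendsto : ∀ K, Tendsto (fun z : ℕ × ℕ => a z.1 / a z.2) (comparablePairs K) (𝓝 1)

theorem tendsto_comparablePairs {ι : Type*} {l : Filter ι} {p q : ι → ℕ} (K : ℕ)
    (hp : Tendsto p l atTop) (hq : Tendsto q l atTop)
    (h : ∀ᶠ i in l, p i ≤ K * q i ∧ q i ≤ K * p i) :
    Tendsto (fun i => (p i, q i)) l (comparablePairs K) :=
  tendsto_inf.2 ⟨hp.prodMk hq, tendsto_principal.2 h⟩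

theorem tendsto_fst_comparablePairs (K : ℕ) : Tendsto Prod.fst (comparablePairs K) atTop :=
  tendsto_fst.mono_left inf_le_left

theorem tendsto_snd_comparablePairs (K : ℕ) : Tendsto Prod.snd (comparablePairs K) atTop :=
  tendsto_snd.mono_left inf_le_left

theorem eventually_comparablePairs_le (K : ℕ) :
    ∀ᶠ z in comparablePairs K, z.1 ≤ K * z.2 ∧ z.2 ≤ K * z.1 :=
  mem_inf_of_right (mem_principal_self _)

theorem tendsto_swap_comparablePairs (K : ℕ) :
    Tendsto Prod.swap (comparablePairs K) (comparablePairs K) :=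
  tendsto_comparablePairs K (tendsto_snd_comparablePairs K) (tendsto_fst_comparablePairs K)
    ((eventually_comparablePairs_le K).mono fun _ h => ⟨h.2, h.1⟩)

theorem eventually_comparablePairs_iff {K : ℕ} {P : ℕ × ℕ → Prop} :
    (∀ᶠ z in comparablePairs K, P z) ↔
      ∃ N, ∀ p q, N ≤ p → N ≤ q → p ≤ K * q → q ≤ K * p → P (p, q) := by
  constructor
  · intro h
    rw [comparablePairs, eventually_inf_principal, eventually_prod_iff] at h
    obtain ⟨pa, ha, pb, hb, H⟩ := h
    obtain ⟨A, hA⟩ := eventually_atTop.1 ha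
    obtain ⟨B, hB⟩ := eventually_atTop.1 hb
    exact ⟨max A B, fun p q hp hq h1 h2 =>
      H (hA p (le_trans (le_max_left _ _) hp)) (hB q (le_trans (le_max_right _ _) hq)) ⟨h1, h2⟩⟩
  · rintro ⟨N, hN⟩
    filter_upwards [(tendsto_fst_comparablePairs K).eventually_ge_atTop N,
      (tendsto_snd_comparablePairs K).eventually_ge_atTop N,
      eventually_comparablePairs_le K] with z h1 h2 h3
    exact hN z.1 z.2 h1 h2 h3.1 h3.2

instance (K : ℕ) : (comparablePairs K).IsCountablyGenerated := by
  unfold comparablePairs; infer_instance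

namespace UnifSlow

variable {a b : ℕ → ℝ}

theorem ratio {ι : Type*} {l : Filter ι} {p q : ι → ℕ} (ha : UnifSlow a) (K : ℕ)
    (hp : Tendsto p l atTop) (hq : Tendsto q l atTop)
    (h : ∀ᶠ i in l, p i ≤ K * q i ∧ q i ≤ K * p i) :
    Tendsto (fun i => a (p i) / a (q i)) l (𝓝 1) :=
  (ha.tendsto K).comp (tendsto_comparablePairs K hp hq h)

theorem bounds (ha : UnifSlow a) (K : ℕ) {ε : ℝ} (hε : 0 < ε) :
    ∃ N, ∀ p q, N ≤ p → N ≤ q → p ≤ K * q → q ≤ K * p →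
      0 < a p ∧ 0 < a q ∧ |a p - a q| ≤ ε * a q := by
  apply (eventually_comparablePairs_iff (P := fun z => 0 < a z.1 ∧ 0 < a z.2 ∧
    |a z.1 - a z.2| ≤ ε * a z.2)).1
  have h1 := (ha.tendsto K).eventually (Metric.ball_mem_nhds 1 hε)
  filter_upwards [h1, (tendsto_fst_comparablePairs K).eventually ha.pos,
    (tendsto_snd_comparablePairs K).eventually ha.pos] with z h1 h2 h3
  refine ⟨h2, h3, ?_⟩
  rw [Real.dist_eq, div_sub_one h3.ne', abs_div, abs_of_pos h3,
    div_lt_iff₀ h3] at h1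
  exact h1.le

theorem mul (ha : UnifSlow a) (hb : UnifSlow b) : UnifSlow (fun n => a n * b n) where
  pos := by filter_upwards [ha.pos, hb.pos] with n h1 h2 using mul_pos h1 h2
  tendsto K := by
    have := (ha.tendsto K).mul (hb.tendsto K)
    simpa [mul_div_mul_comm] using this

theorem inv (ha : UnifSlow a) : UnifSlow (fun n => (a n)⁻¹) where
  pos := by filter_upwards [ha.pos] with n h1 using inv_pos.2 h1
  tendsto K := by
    have := (ha.tendsto K).inv₀ one_ne_zero
    simpa [div_eq_mul_inv, mul_comm] using this

theorem const {c : ℝ} (hc : 0 < c) : UnifSlow (fun _ => c) where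
  pos := by simp [hc]
  tendsto K := by simp [div_self hc.ne', tendsto_const_nhds]

theorem congr (ha : UnifSlow a) (h : Tendsto (fun n => b n / a n) atTop (𝓝 1)) :
    UnifSlow b where
  pos := by
    filter_upwards [ha.pos, h.eventually (lt_mem_nhds one_pos)] with n h1 h2
    simpa [div_pos_iff, h1, h1.le, h1.not_gt] using h2
  tendsto K := by
    have h1 := (h.comp (tendsto_fst_comparablePairs K)).mul ((ha.tendsto K).mul
      ((h.comp (tendsto_snd_comparablePairs K)).inv₀ one_ne_zero))
    simp only [mul_one, inv_one] at h1
    refine h1.congr' ?_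
    filter_upwards [(tendsto_fst_comparablePairs K).eventually ha.pos,
      (tendsto_snd_comparablePairs K).eventually ha.pos] with z h2 h3
    simp only [Function.comp]
    field_simp

theorem congr' (ha : UnifSlow a) (h : b =ᶠ[atTop] a) : UnifSlow b := by
  refine ha.congr (tendsto_const_nhds.congr' ?_)
  filter_upwards [ha.pos, h] with n h1 h2
  rw [h2, div_self h1.ne']

/-- It is enough to compare `a p` with `a q` for `q ≤ p ≤ K * q`. -/
theorem of_le (hpos : ∀ᶠ n in atTop, 0 < a n)
    (h : ∀ K : ℕ, ∀ ε : ℝ, 0 < ε → ∃ N, ∀ p q, N ≤ q → q ≤ p → p ≤ K * q →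
      |a p / a q - 1| < ε) : UnifSlow a where
  pos := hpos
  tendsto K := by
    have key : Tendsto (fun z : ℕ × ℕ => a z.1 / a z.2) (comparablePairs K ⊓ 𝓟 {z | z.2 ≤ z.1})
        (𝓝 1) := by
      rw [Metric.tendsto_nhds]
      intro ε hε
      rw [eventually_inf_principal, eventually_comparablePairs_iff]
      obtain ⟨N, hN⟩ := h K ε hε
      exact ⟨N, fun p q _ hq h1 _ h3 => by rw [Real.dist_eq]; exact hN p q hq h3 h1⟩
    have key2 : Tendsto (fun z : ℕ × ℕ => a z.1 / a z.2) (comparablePairs K ⊓ 𝓟 {z | z.1 ≤ z.2})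
        (𝓝 1) := by
      have hs : Tendsto Prod.swap (comparablePairs K ⊓ 𝓟 {z : ℕ × ℕ | z.1 ≤ z.2})
          (comparablePairs K ⊓ 𝓟 {z : ℕ × ℕ | z.2 ≤ z.1}) :=
        tendsto_inf.2 ⟨(tendsto_swap_comparablePairs K).mono_left inf_le_left,
          tendsto_principal.2 (mem_inf_of_right fun _ h => h)⟩
      have := (key.comp hs).inv₀ one_ne_zero
      simpa [Function.comp_def] using this
    have := key.sup key2
    rw [← inf_sup_left, sup_principal] at this
    have huniv : {z : ℕ × ℕ | z.2 ≤ z.1} ∪ {z : ℕ × ℕ | z.1 ≤ z.2} = Set.univ := by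
      ext z; simpa using le_total _ _
    simpa [huniv] using this

end UnifSlow

/-- The uniform convergence theorem, along the integers. -/
theorem SlowlyVarying.unifSlow {φ : ℝ → ℝ} (hφ : SlowlyVarying φ) :
    UnifSlow (fun n : ℕ => φ n) where
  pos := by
    filter_upwards [eventually_gt_atTop 0] with n hn
    exact hφ.pos _ (by exact_mod_cast hn)
  tendsto K := by
    -- Logarithmic coordinates turn scaling into translation.
    set h : ℝ → ℝ := fun x => Real.log (φ (Real.exp x)) with hh
    have hmeas : Measurable h :=
      Real.measurable_log.comp (hφ.measurable.comp Real.measurable_exp)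
    have hlim : ∀ v : ℝ, Tendsto (fun x => h (x + v) - h x) atTop (𝓝 0) := by
      intro v
      have h1 := ((hφ.tendsto (Real.exp v) (Real.exp_pos v)).comp Real.tendsto_exp_atTop).log
        one_ne_zero
      rw [Real.log_one] at h1
      refine h1.congr fun x => ?_
      simp only [Function.comp, hh]
      rw [Real.log_div (hφ.pos _ (by positivity)).ne' (hφ.pos _ (by positivity)).ne',
        Real.exp_add, mul_comm]
    have huct : ∀ (A : ℝ) (x u : ℕ → ℝ), 0 ≤ A → Tendsto x atTop atTop →
        (∀ᶠ n in atTop, |u n| ≤ A) →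
        Tendsto (fun n => h (x n + u n) - h (x n)) atTop (𝓝 0) := by
      intro A x u hA hx hu
      -- If v ∈ [A, A + 1] and |u| ≤ A, then v and v - u both lie in [0, T]. The increments from x
      -- and from x + u are each small off a set of measure below 1/2. These two bad sets, the
      -- second one translated, cannot cover an interval of length 1, so some v compares both h(x)
      -- and h(x + u) with h(x + v).
      set T : ℝ := 2 * A + 1 with hT
      have hmeasure : ∀ y : ℕ → ℝ, Tendsto y atTop atTop → ∀ ε : ℝ, 0 < ε →
          ∀ᶠ n in atTop, volume {v | v ∈ Set.Icc 0 T ∧ ε ≤ |h (y n + v) - h (y n)|} < 1 / 2 := by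
        intro y hy ε hε
        have h1 : TendstoInMeasure (volume.restrict (Set.Icc (0 : ℝ) T))
            (fun n v => h (y n + v) - h (y n)) atTop (fun _ => (0 : ℝ)) := by
          apply tendstoInMeasure_of_tendsto_ae
          · intro n
            exact ((hmeas.comp (measurable_const_add _)).sub_const _).aestronglyMeasurable
          · exact Eventually.of_forall fun v => (hlim v).comp hy
        have h2 := (h1 (ENNReal.ofReal ε) (by simpa using hε)).eventually
          (gt_mem_nhds (show (0 : ENNReal) < 1 / 2 by simp))
        filter_upwards [h2] with n hn
        refine lt_of_le_of_lt ?_ hn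
        rw [Measure.restrict_apply' measurableSet_Icc]
        refine measure_mono fun v hv => ⟨?_, hv.1⟩
        simp only [Set.mem_ofPred_eq, edist_dist, Real.dist_eq, sub_zero]
        exact ENNReal.ofReal_le_ofReal hv.2
      have hxu : Tendsto (fun n => x n + u n) atTop atTop := by
        refine tendsto_atTop_mono' _ ?_ (tendsto_atTop_add_const_right _ (-A) hx)
        filter_upwards [hu] with n hn
        linarith [(abs_le.1 hn).1]
      rw [Metric.tendsto_nhds]
      intro ε hε
      filter_upwards [hmeasure x hx (ε / 2) (half_pos hε),
        hmeasure _ hxu (ε / 2) (half_pos hε), hu] with n h1 h2 h3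
      obtain ⟨h3a, h3b⟩ := abs_le.1 h3
      set V := {v | v ∈ Set.Icc 0 T ∧ ε / 2 ≤ |h (x n + v) - h (x n)|}
      set W := {v | v ∈ Set.Icc 0 T ∧ ε / 2 ≤ |h (x n + u n + v) - h (x n + u n)|}
      have hW : volume ((fun v => v + (- u n)) ⁻¹' W) < 1 / 2 := by
        rwa [measure_preimage_add_right]
      have hsub : ¬ Set.Icc A (A + 1) ⊆ V ∪ (fun v => v + (- u n)) ⁻¹' W := by
        intro hsub
        have := (measure_mono hsub).trans (measure_union_le (μ := volume) _ _)
        rw [Real.volume_Icc] at this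
        have h4 := lt_of_le_of_lt this (ENNReal.add_lt_add h1 hW)
        rw [ENNReal.add_halves] at h4
        simp at h4
      obtain ⟨v, hv, hv'⟩ := Set.not_subset.1 hsub
      simp only [Set.mem_union, not_or, Set.mem_preimage] at hv'
      have hv1 : |h (x n + v) - h (x n)| < ε / 2 := by
        by_contra hc
        exact hv'.1 ⟨⟨by linarith [hv.1], by linarith [hv.2]⟩, not_lt.1 hc⟩
      have hv2 : |h (x n + v) - h (x n + u n)| < ε / 2 := by
        by_contra hc
        refine hv'.2 ⟨⟨by linarith [hv.1], by linarith [hv.2]⟩, ?_⟩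
        rw [show x n + u n + (v + - u n) = x n + v by ring]
        exact not_lt.1 hc
      rw [Real.dist_eq, sub_zero]
      calc |h (x n + u n) - h (x n)|
          = |(h (x n + v) - h (x n)) - (h (x n + v) - h (x n + u n))| := by ring_nf
        _ ≤ _ := abs_sub _ _
        _ < ε := by linarith
    apply tendsto_of_seq_tendsto
    intro z hz
    have hz1 := (tendsto_fst_comparablePairs K).comp hz
    have hz2 := (tendsto_snd_comparablePairs K).comp hz
    have hz3 := hz.eventually (eventually_comparablePairs_le K)
    have hlogx : Tendsto (fun n => Real.log ((z n).2 : ℝ)) atTop atTop :=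
      Real.tendsto_log_atTop.comp (tendsto_natCast_atTop_atTop.comp hz2)
    have hev : ∀ᶠ n in atTop, 0 < ((z n).1 : ℝ) ∧ 0 < ((z n).2 : ℝ) := by
      filter_upwards [hz1.eventually_gt_atTop 0, hz2.eventually_gt_atTop 0] with n h1 h2
      simp only [Function.comp] at h1 h2
      exact ⟨by exact_mod_cast h1, by exact_mod_cast h2⟩
    have hlog : ∀ᶠ n in atTop,
        |Real.log ((z n).1 : ℝ) - Real.log ((z n).2 : ℝ)| ≤ Real.log K := by
      filter_upwards [hev, hz3] with n ⟨h1, h2⟩ ⟨h3, h4⟩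
      have hK : (0 : ℝ) < K := by
        rcases Nat.eq_zero_or_pos K with rfl | hK
        · simp at h3; simp [h3] at h1
        · exact_mod_cast hK
      have h3' := Real.log_le_log h1 (show ((z n).1 : ℝ) ≤ K * (z n).2 by exact_mod_cast h3)
      have h4' := Real.log_le_log h2 (show ((z n).2 : ℝ) ≤ K * (z n).1 by exact_mod_cast h4)
      rw [Real.log_mul hK.ne' h2.ne'] at h3'
      rw [Real.log_mul hK.ne' h1.ne'] at h4'
      rw [abs_le]; constructor <;> linarith
    have h5 := huct (Real.log K) (fun n => Real.log ((z n).2 : ℝ))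
      (fun n => Real.log ((z n).1 : ℝ) - Real.log ((z n).2 : ℝ)) (Real.log_natCast_nonneg K)
      hlogx hlog
    have h6 := (Real.continuous_exp.tendsto 0).comp h5
    rw [Real.exp_zero] at h6
    refine h6.congr' ?_
    filter_upwards [hev] with n ⟨h1, h2⟩
    simp only [Function.comp, hh]
    rw [add_sub_cancel, Real.exp_log h1, Real.exp_log h2, Real.exp_sub,
      Real.exp_log (hφ.pos _ h1), Real.exp_log (hφ.pos _ h2)]

namespace UnifSlow

variable {a : ℕ → ℝ}

theorem exists_slowlyVarying (ha : UnifSlow a) :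
    ∃ L : ℝ → ℝ, SlowlyVarying L ∧ ∀ᶠ n : ℕ in atTop, a n = L n := by
  classical
  -- Only finitely many values are changed; this makes the step function x ↦ b ⌊x⌋ positive
  -- everywhere.
  set b : ℕ → ℝ := fun n => if 0 < a n then a n else 1 with hb
  have hab : a =ᶠ[atTop] b := by
    filter_upwards [ha.pos] with n hn
    simp [hb, hn]
  have hbs : UnifSlow b := ha.congr' hab.symm
  refine ⟨fun x => b ⌊x⌋₊, ⟨?_, ?_, ?_⟩, ?_⟩
  · exact (measurable_from_top (f := b)).comp Nat.measurable_floor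
  · intro x _
    simp only [hb]
    split_ifs with h
    exacts [h, one_pos]
  · intro c hc
    -- For y ≥ 1 the floor loses at most a factor 2, so ⌊c x⌋ and ⌊x⌋ are within the factors 2c and
    -- 2/c of each other.
    obtain ⟨K, hK⟩ := exists_nat_ge (2 * c + 2 / c)
    have hc2 : 2 * c ≤ K := le_trans (by have : 0 < 2 / c := by positivity
                                         linarith) hK
    have hc3 : 2 / c ≤ K := le_trans (by linarith) hK
    refine hbs.ratio K (tendsto_nat_floor_atTop.comp (tendsto_id.const_mul_atTop hc))
      tendsto_nat_floor_atTop ?_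
    filter_upwards [eventually_ge_atTop 1, eventually_ge_atTop (1 / c)] with x h1 h2
    have h2' : 1 ≤ c * x := by rwa [div_le_iff₀ hc, mul_comm] at h2
    have hfl : ∀ y : ℝ, 1 ≤ y → y ≤ 2 * (⌊y⌋₊ : ℝ) ∧ (⌊y⌋₊ : ℝ) ≤ y := by
      intro y hy
      have h3 := Nat.lt_floor_add_one y
      have h4 : (1 : ℝ) ≤ (⌊y⌋₊ : ℝ) := by exact_mod_cast (Nat.one_le_floor_iff y).2 hy
      exact ⟨by linarith, Nat.floor_le (by linarith)⟩
    obtain ⟨h3, h4⟩ := hfl x h1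
    obtain ⟨h5, h6⟩ := hfl _ h2'
    have h7 : (0 : ℝ) ≤ (⌊x⌋₊ : ℝ) := by positivity
    constructor
    · have : ((⌊c * x⌋₊ : ℕ) : ℝ) ≤ K * ⌊x⌋₊ := by nlinarith
      exact_mod_cast this
    · have h8 : x ≤ (1 / c) * (2 * ⌊c * x⌋₊) := by
        rw [one_div, inv_mul_eq_div, le_div_iff₀ hc]; linarith
      have : ((⌊x⌋₊ : ℕ) : ℝ) ≤ K * ⌊c * x⌋₊ := by
        calc (⌊x⌋₊ : ℝ) ≤ (1 / c) * (2 * ⌊c * x⌋₊) := h4.trans h8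
          _ = 2 / c * ⌊c * x⌋₊ := by ring
          _ ≤ _ := by gcongr
      exact_mod_cast this
  · filter_upwards [hab] with n hn
    simpa using hn

theorem seqSlowlyVarying (ha : UnifSlow a) : SeqSlowlyVarying a := by
  obtain ⟨L, hL, h⟩ := ha.exists_slowlyVarying
  exact ⟨L, hL, by simpa using h⟩

theorem seqRegularlyVaryingWithIndex_neg_one (ha : UnifSlow (fun n => n * a n)) :
    SeqRegularlyVaryingWithIndex a (-1) := by
  obtain ⟨L, hL, h⟩ := ha.exists_slowlyVarying
  refine ⟨L, hL, ?_⟩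
  filter_upwards [h, eventually_gt_atTop 0] with n h1 h2
  have : (n : ℝ) ≠ 0 := by exact_mod_cast h2.ne'
  rw [← h1, Real.rpow_neg_one]
  field_simp

/-- A cheap half of Karamata's theorem. -/
theorem exists_sum_le (ha : UnifSlow a) :
    ∃ C, 0 < C ∧ ∀ᶠ n : ℕ in atTop, ∑ k ∈ Finset.range (n + 1), a k ≤ C * (n * a n) := by
  obtain ⟨N, hN⟩ := ha.bounds 3 (show (0 : ℝ) < 1 / 10 by norm_num)
  set S : ℕ → ℝ := fun n => ∑ k ∈ Finset.range (n + 1), a k with hS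
  set M := N + 2 with hM
  set B : ℝ := ∑ n ∈ Finset.range (2 * M + 2), |S n / (n * a n)| with hB
  have hB0 : 0 ≤ B := Finset.sum_nonneg fun _ _ => abs_nonneg _
  have hpos : ∀ n, M ≤ n → 0 < n * a n := fun n hn =>
    mul_pos (by exact_mod_cast (by omega : 0 < n))
      (hN n n (by omega) (by omega) (by omega) (by omega)).1
  -- `B` covers the finitely many n below `2 * M + 2`. Beyond them, halving n reproduces a constant
  -- C as long as (11/20) C + 11/10 ≤ C, which holds for C ≥ 10.
  refine ⟨B + 10, by positivity, eventually_atTop.2 ⟨M, fun n => ?_⟩⟩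
  induction n using Nat.strong_induction_on with
  | _ n ih =>
    intro hn
    rcases lt_or_ge n (2 * M + 2) with hlt | hge
    · have h1 : |S n / (n * a n)| ≤ B :=
        Finset.single_le_sum (f := fun n : ℕ => |S n / (n * a n)|) (fun _ _ => abs_nonneg _)
          (Finset.mem_range.2 hlt)
      have h2 := (le_abs_self _).trans h1
      rw [div_le_iff₀ (hpos n hn)] at h2
      have := hpos n hn
      change S n ≤ _
      linarith
    · have ih' := ih (n / 2) (by omega) (by omega)
      obtain ⟨h1, h2, h3⟩ := hN (n / 2) n (by omega) (by omega) (by omega) (by omega)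
      have hhalf : ((n / 2 : ℕ) : ℝ) ≤ n / 2 := Nat.cast_div_le
      have hsplit : S n = S (n / 2) + ∑ k ∈ Finset.Ico (n / 2 + 1) (n + 1), a k := by
        simp only [hS]
        rw [Finset.sum_range_add_sum_Ico _ (by omega)]
      have hIco : ∑ k ∈ Finset.Ico (n / 2 + 1) (n + 1), a k ≤ n * (11 / 10 * a n) := by
        have h4 : ∀ k ∈ Finset.Ico (n / 2 + 1) (n + 1), a k ≤ 11 / 10 * a n := by
          intro k hk
          rw [Finset.mem_Ico] at hk
          have := (hN k n (by omega) (by omega) (by omega) (by omega)).2.2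
          linarith [(abs_le.1 this).2]
        refine (Finset.sum_le_card_nsmul _ _ _ h4).trans ?_
        rw [nsmul_eq_mul, Nat.card_Ico]
        have h5 : ((n + 1 - (n / 2 + 1) : ℕ) : ℝ) ≤ n := by exact_mod_cast (by omega)
        gcongr
      have h6 : a (n / 2) ≤ 11 / 10 * a n := by linarith [(abs_le.1 h3).2]
      change S n ≤ _
      change S (n / 2) ≤ _ at ih'
      have h7 : ((n / 2 : ℕ) : ℝ) * a (n / 2) ≤ (n / 2) * (11 / 10 * a n) := by gcongr
      have h8 : (B + 10) * (((n / 2 : ℕ) : ℝ) * a (n / 2)) ≤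
          (B + 10) * ((n / 2) * (11 / 10 * a n)) := by gcongr
      have h9 := hpos n hn
      have h10 : 0 ≤ B * (n * a n) := by positivity
      linarith

end UnifSlow

/-! ### Convolutions and partial sums. -/

open Finset in
/-- The convolution of two sequences. -/
def conv (a b : ℕ → ℝ) (n : ℕ) : ℝ := ∑ z ∈ antidiagonal n, a z.1 * b z.2

/-- The partial sum `a 0 + ⋯ + a n`. -/
def psum (a : ℕ → ℝ) (n : ℕ) : ℝ := ∑ k ∈ Finset.range (n + 1), a k

theorem psum_succ (a : ℕ → ℝ) (n : ℕ) : psum a (n + 1) = psum a n + a (n + 1) :=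
  Finset.sum_range_succ _ _

theorem psum_zero (a : ℕ → ℝ) : psum a 0 = a 0 := by simp [psum]

theorem psum_mono {a : ℕ → ℝ} (ha : ∀ n, 0 ≤ a n) : Monotone (psum a) :=
  monotone_nat_of_le_succ fun n => by rw [psum_succ]; linarith [ha (n + 1)]

theorem psum_nonneg {a : ℕ → ℝ} (ha : ∀ n, 0 ≤ a n) (n : ℕ) : 0 ≤ psum a n :=
  Finset.sum_nonneg fun _ _ => ha _

theorem conv_nonneg {a b : ℕ → ℝ} (ha : ∀ n, 0 ≤ a n) (hb : ∀ n, 0 ≤ b n) (n : ℕ) :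
    0 ≤ conv a b n :=
  Finset.sum_nonneg fun _ _ => mul_nonneg (ha _) (hb _)

theorem conv_comm (a b : ℕ → ℝ) (n : ℕ) : conv a b n = conv b a n := by
  unfold conv
  rw [← Finset.Nat.sum_antidiagonal_swap]
  exact Finset.sum_congr rfl fun _ _ => mul_comm _ _

theorem conv_eq_range (a b : ℕ → ℝ) (n : ℕ) :
    conv a b n = ∑ k ∈ Finset.range (n + 1), a k * b (n - k) :=
  Finset.Nat.sum_antidiagonal_eq_sum_range_succ (fun i j => a i * b j) n

theorem psum_conv (a b : ℕ → ℝ) (n : ℕ) : psum (conv a b) n = conv a (psum b) n := by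
  induction n with
  | zero => simp [psum, conv]
  | succ n ih =>
    rw [psum_succ, ih, conv_eq_range, conv_eq_range, conv_eq_range,
      Finset.sum_range_succ _ (n + 1), Finset.sum_range_succ _ (n + 1), Nat.sub_self, psum_zero,
      ← add_assoc, ← Finset.sum_add_distrib]
    congr 1
    refine Finset.sum_congr rfl fun k hk => ?_
    rw [Finset.mem_range] at hk
    rw [show n + 1 - k = n - k + 1 by omega, psum_succ]
    ring

/-- The triangle i + j ≤ n lies in the square of side n. -/
theorem psum_conv_le {a b : ℕ → ℝ} (ha : ∀ n, 0 ≤ a n) (hb : ∀ n, 0 ≤ b n) (n : ℕ) :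
    psum (conv a b) n ≤ psum a n * psum b n := by
  rw [psum_conv, conv_eq_range, psum, Finset.sum_mul]
  exact Finset.sum_le_sum fun k _ =>
    mul_le_mul_of_nonneg_left (psum_mono hb (Nat.sub_le _ _)) (ha _)

/-- The triangle i + j ≤ n contains the square of side n / 2. -/
theorem le_psum_conv {a b : ℕ → ℝ} (ha : ∀ n, 0 ≤ a n) (hb : ∀ n, 0 ≤ b n) (n : ℕ) :
    psum a (n / 2) * psum b (n / 2) ≤ psum (conv a b) n := by
  rw [psum_conv, conv_eq_range]
  nth_rw 1 [psum]
  rw [Finset.sum_mul]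
  refine (Finset.sum_le_sum fun k hk => ?_).trans (Finset.sum_le_sum_of_subset_of_nonneg
    (Finset.range_subset_range.2 (by omega : n / 2 + 1 ≤ n + 1))
    fun k _ _ => mul_nonneg (ha k) (psum_nonneg hb _))
  rw [Finset.mem_range] at hk
  exact mul_le_mul_of_nonneg_left (psum_mono hb (by omega)) (ha _)

/-- In each product one of the two indices is at least n / 2; that factor is bounded by `M` and the
other is summed. -/
theorem conv_self_le {u : ℕ → ℝ} (hu : ∀ n, 0 ≤ u n) {n : ℕ} {M : ℝ}
    (hM : ∀ k, n ≤ 2 * k → k ≤ n → u k ≤ M) : conv u u n ≤ 2 * M * psum u n := by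
  have hM0 : 0 ≤ M := (hu n).trans (hM n (by omega) le_rfl)
  rw [conv_eq_range]
  have h1 : ∀ k ∈ Finset.range (n + 1), u k * u (n - k) ≤ M * u k + M * u (n - k) := by
    intro k hk
    rw [Finset.mem_range] at hk
    rcases le_total n (2 * k) with h | h
    · have := mul_le_mul_of_nonneg_right (hM k h (by omega)) (hu (n - k))
      have := mul_nonneg hM0 (hu k)
      linarith
    · have := mul_le_mul_of_nonneg_left (hM (n - k) (by omega) (by omega)) (hu k)
      have := mul_nonneg hM0 (hu (n - k))
      linarith
  refine (Finset.sum_le_sum h1).trans (le_of_eq ?_)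
  rw [Finset.sum_add_distrib, ← Finset.mul_sum, ← Finset.mul_sum]
  have := Finset.sum_range_reflect u (n + 1)
  simp only [Nat.add_sub_cancel] at this
  rw [this, psum]
  ring

/-! ### The renewal equation. -/

/-- The renewal equation `u = δ₀ + f * u` for nonnegative sequences, `r` being the tail of the
probability `f`. -/
structure RenewalSeq (f r u : ℕ → ℝ) : Prop where
  f_nonneg : ∀ n, 0 ≤ f n
  u_nonneg : ∀ n, 0 ≤ u n
  r_nonneg : ∀ n, 0 ≤ r n
  r_zero : r 0 = 1
  f_zero : f 0 = 0
  r_sub : ∀ n, r n - r (n + 1) = f (n + 1)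
  eq : ∀ n, u n = (if n = 0 then 1 else 0) + conv f u n

open PowerSeries in
theorem coeff_mk_mul_mk (a b : ℕ → ℝ) (n : ℕ) :
    coeff n (mk a * mk b) = conv a b n := by
  simp [coeff_mul, conv]

namespace RenewalSeq

variable {f r u : ℕ → ℝ}

open PowerSeries in
theorem mk_eq (h : RenewalSeq f r u) : PowerSeries.mk u = 1 + PowerSeries.mk f * PowerSeries.mk u := by
  ext n
  rw [map_add, coeff_mk_mul_mk, coeff_mk, h.eq n, coeff_one]

open PowerSeries in
/-- The identity `z U' = z F' U²`. -/
theorem mul_eq_conv (h : RenewalSeq f r u) (n : ℕ) :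
    n * u n = conv (fun j => j * f j) (conv u u) n := by
  have hX : ∀ a : ℕ → ℝ, X * derivative ℝ (PowerSeries.mk a) = PowerSeries.mk fun j => (j : ℝ) * a j := by
    intro a
    ext n
    cases n with
    | zero => simp
    | succ n => rw [coeff_succ_X_mul, coeff_derivative]; simp [mul_comm]
  have h1 : PowerSeries.mk (conv u u) = PowerSeries.mk u * PowerSeries.mk u := by
    ext n; rw [coeff_mk_mul_mk, coeff_mk]
  -- Differentiate U = 1 + F U, multiply by U, and use U (1 - F) = 1.
  have h2 : X * derivative ℝ (PowerSeries.mk u) = X * derivative ℝ (PowerSeries.mk f) * (PowerSeries.mk u * PowerSeries.mk u) := by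
    have h3 : derivative ℝ (PowerSeries.mk u) = PowerSeries.mk f * derivative ℝ (PowerSeries.mk u) + PowerSeries.mk u * derivative ℝ (PowerSeries.mk f) := by
      have := congrArg (derivative ℝ) h.mk_eq
      rw [map_add, Derivation.leibniz, smul_eq_mul, smul_eq_mul, Derivation.map_one_eq_zero,
        zero_add] at this
      exact this
    have h4 : PowerSeries.mk u * (1 - PowerSeries.mk f) = 1 := by
      linear_combination h.mk_eq
    linear_combination (X * PowerSeries.mk u) * h3 - (X * derivative ℝ (PowerSeries.mk u)) * h4
  rw [hX, hX, ← h1] at h2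
  have := congrArg (coeff n) h2
  rwa [coeff_mk_mul_mk, coeff_mk] at this

-- With R the generating function of the tail, R (1 - z) = 1 - F = 1 / U, hence U R = 1 / (1 - z).
-- In probabilistic terms, some renewal is the last one up to time n.
open PowerSeries in
theorem conv_tail (h : RenewalSeq f r u) (n : ℕ) : conv u r n = 1 := by
  have h1 : PowerSeries.mk r * (1 - X) = 1 - PowerSeries.mk f := by
    ext n
    rw [mul_sub, mul_one, map_sub, map_sub]
    cases n with
    | zero => simp [h.r_zero, h.f_zero]
    | succ n => rw [coeff_succ_mul_X]; simp [coeff_one]; linarith [h.r_sub n]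
  have h4 : PowerSeries.mk u * (1 - PowerSeries.mk f) = 1 := by
    linear_combination h.mk_eq
  have h5 : PowerSeries.mk u * PowerSeries.mk r * (1 - X) = 1 := by rw [mul_assoc, h1, h4]
  have h6 : (PowerSeries.mk fun _ => (1 : ℝ)) * (1 - X) = 1 := by
    exact PowerSeries.mk_one_mul_one_sub_eq_one ℝ
  have h7 : PowerSeries.mk u * PowerSeries.mk r = PowerSeries.mk fun _ => (1 : ℝ) := by
    linear_combination (PowerSeries.mk fun _ => (1 : ℝ)) * h5 - (PowerSeries.mk u * PowerSeries.mk r) * h6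
  rw [← coeff_mk_mul_mk, h7, coeff_mk]

theorem antitone (h : RenewalSeq f r u) : Antitone r :=
  antitone_nat_of_succ_le fun n => by linarith [h.r_sub n, h.f_nonneg (n + 1)]

theorem psum_mul_tail_le (h : RenewalSeq f r u) (n : ℕ) : psum u n * r n ≤ 1 := by
  rw [← h.conv_tail n, conv_eq_range, psum, Finset.sum_mul]
  exact Finset.sum_le_sum fun k _ =>
    mul_le_mul_of_nonneg_left (h.antitone (Nat.sub_le _ _)) (h.u_nonneg k)

theorem psum_tail (h : RenewalSeq f r u) (n : ℕ) :
    psum r n = (n + 1) * r n + psum (fun j => j * f j) n := by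
  induction n with
  | zero => simp [psum]
  | succ n ih =>
    rw [psum_succ, psum_succ, ih, ← h.r_sub]
    push_cast
    ring

theorem le_psum_mul (h : RenewalSeq f r u) (n : ℕ) : (n + 1 : ℝ) ≤ psum u n * psum r n := by
  have h1 : psum (conv u r) n = n + 1 := by
    rw [psum, Finset.sum_congr rfl fun k _ => h.conv_tail k]
    simp
  rw [← h1]
  exact psum_conv_le h.u_nonneg h.r_nonneg n

/-- Both bounds come from u * r = 1. Monotonicity of r gives U_n r_n ≤ 1. Summing gives n + 1 ≤ U_n
(r_0 + ⋯ + r_n), where the last factor is (n + 1) r_n plus the truncated first moment, assumed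
negligible here. -/
theorem tendsto_psum_mul_tail (h : RenewalSeq f r u) (hr : ∀ n, 0 < r n)
    (hJ : Tendsto (fun n : ℕ => psum (fun j => j * f j) n / (n * r n)) atTop (𝓝 0)) :
    Tendsto (fun n => psum u n * r n) atTop (𝓝 1) := by
  have hJ0 : ∀ n, 0 ≤ psum (fun j => j * f j) n :=
    psum_nonneg fun j => mul_nonneg (Nat.cast_nonneg j) (h.f_nonneg j)
  have h1 : Tendsto (fun n : ℕ => (1 + psum (fun j => j * f j) n / (n * r n))⁻¹) atTop (𝓝 1) := by
    simpa using (hJ.const_add 1).inv₀ (by norm_num)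
  refine tendsto_of_tendsto_of_tendsto_of_le_of_le' h1 tendsto_const_nhds ?_
    (Eventually.of_forall h.psum_mul_tail_le)
  filter_upwards [eventually_gt_atTop 0] with n hn
  have hn' : (0 : ℝ) < n := by exact_mod_cast hn
  have hrn := hr n
  have h2 := h.le_psum_mul n
  rw [h.psum_tail] at h2
  have hU : 0 ≤ psum u n := psum_nonneg h.u_nonneg n
  set J := psum (fun j => j * f j) n
  have hJn : 0 ≤ J := hJ0 n
  rw [inv_le_iff_one_le_mul₀ (by positivity)]
  have h3 : J ≤ (n + 1) * r n * (J / (n * r n)) := by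
    rw [mul_div_assoc', le_div_iff₀ (by positivity)]
    nlinarith [mul_nonneg hrn.le hJn]
  have h4 : (n + 1 : ℝ) ≤ (n + 1) * (psum u n * r n * (1 + J / (n * r n))) := by
    calc (n + 1 : ℝ) ≤ _ := h2
      _ ≤ psum u n * ((n + 1) * r n + (n + 1) * r n * (J / (n * r n))) := by gcongr
      _ = _ := by ring
  have h5 : (0 : ℝ) < n + 1 := by positivity
  exact le_of_mul_le_mul_left (by linarith) h5

/-- If `f = (δ₁ + g) / 2` with `g` a sub-probability on the even numbers, the alternating partial
sums of `u` stay bounded. -/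
theorem psum_alternating_mem (h : RenewalSeq f r u) {g : ℕ → ℝ} (hg : ∀ n, 0 ≤ g n)
    (hg1 : ∀ n, psum g n ≤ 1) (hodd : ∀ n, ¬ Even n → g n = 0)
    (hf : ∀ n, f n = 1 / 2 * (if n = 1 then 1 else 0) + 1 / 2 * g n) (n : ℕ) :
    0 ≤ psum (fun k => (-1) ^ k * u k) n ∧ psum (fun k => (-1) ^ k * u k) n ≤ 2 := by
  set d : ℕ → ℝ := fun n => if n = 1 then 1 else 0 with hd
  set v : ℕ → ℝ := fun k => (-1) ^ k * u k with hv
  have hu : ∀ n, u n = (if n = 0 then 1 else 0) + 1 / 2 * conv d u n + 1 / 2 * conv g u n := by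
    intro n
    rw [h.eq n, add_assoc]
    congr 1
    simp only [conv, Finset.mul_sum, ← Finset.sum_add_distrib]
    exact Finset.sum_congr rfl fun z _ => by rw [hf]; ring
  have hve : ∀ n, v n = (if n = 0 then 1 else 0) - 1 / 2 * conv d v n + 1 / 2 * conv g v n := by
    intro n
    have h1 : (-1) ^ n * conv d u n = - conv d v n := by
      simp only [conv, Finset.mul_sum, ← Finset.sum_neg_distrib]
      refine Finset.sum_congr rfl fun z hz => ?_
      rw [Finset.HasAntidiagonal.mem_antidiagonal] at hz
      simp only [hd, hv]
      split_ifs with h1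
      · rw [← hz, h1, pow_add]; ring
      · ring
    have h2 : (-1) ^ n * conv g u n = conv g v n := by
      simp only [conv, Finset.mul_sum]
      refine Finset.sum_congr rfl fun z hz => ?_
      rw [Finset.HasAntidiagonal.mem_antidiagonal] at hz
      simp only [hv]
      by_cases h1 : Even z.1
      · rw [← hz, pow_add, h1.neg_one_pow]; ring
      · rw [hodd _ h1]; ring
    have h3 : (-1) ^ n * (if n = 0 then 1 else 0 : ℝ) = if n = 0 then 1 else 0 := by
      split_ifs with h0 <;> simp [h0]
    have := hu n
    simp only [hv]
    rw [this]
    linear_combination h3 + 1 / 2 * h1 + 1 / 2 * h2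
  -- Parts of u on even and on odd indices. A gap 1 exchanges parities and a gap from `g` preserves
  -- them, which couples the two renewal equations `heo` and `hoe`.
  set e : ℕ → ℝ := fun k => (u k + v k) / 2 with he
  set o : ℕ → ℝ := fun k => (u k - v k) / 2 with ho
  have hpm : ∀ k, |v k| = u k := fun k => by
    simp only [hv]
    rw [abs_mul, abs_pow, abs_neg, abs_one, one_pow, one_mul, abs_of_nonneg (h.u_nonneg k)]
  have he0 : ∀ k, 0 ≤ e k := fun k => by
    simp only [he]; linarith [neg_abs_le (v k), hpm k]
  have ho0 : ∀ k, 0 ≤ o k := fun k => by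
    simp only [ho]; linarith [le_abs_self (v k), hpm k]
  have hd0 : ∀ k, 0 ≤ d k := fun k => by simp only [hd]; split_ifs <;> norm_num
  have hd1 : ∀ k, psum d k ≤ 1 := fun k => by
    simp only [psum, hd, Finset.sum_ite_eq']; split_ifs <;> norm_num
  have hconv : ∀ a : ℕ → ℝ, ∀ n, conv a e n = (conv a u n + conv a v n) / 2 := by
    intro a n
    simp only [conv, he, ← Finset.sum_add_distrib, Finset.sum_div]
    exact Finset.sum_congr rfl fun _ _ => by ring
  have hconv' : ∀ a : ℕ → ℝ, ∀ n, conv a o n = (conv a u n - conv a v n) / 2 := by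
    intro a n
    simp only [conv, ho, ← Finset.sum_sub_distrib, Finset.sum_div]
    exact Finset.sum_congr rfl fun _ _ => by ring
  have heo : ∀ n, e n = (if n = 0 then 1 else 0) + 1 / 2 * conv d o n + 1 / 2 * conv g e n := by
    intro n
    rw [hconv, hconv']
    simp only [he]
    linear_combination 1 / 2 * hu n + 1 / 2 * hve n
  have hoe : ∀ n, o n = 1 / 2 * conv d e n + 1 / 2 * conv g o n := by
    intro n
    rw [hconv, hconv']
    simp only [ho]
    linear_combination 1 / 2 * hu n - 1 / 2 * hve n
  have hE : psum e n = 1 + 1 / 2 * psum (conv d o) n + 1 / 2 * psum (conv g e) n := by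
    have : psum e n = ∑ k ∈ Finset.range (n + 1),
        ((if k = 0 then 1 else 0) + 1 / 2 * conv d o k + 1 / 2 * conv g e k) :=
      Finset.sum_congr rfl fun k _ => heo k
    rw [this, Finset.sum_add_distrib, Finset.sum_add_distrib, ← Finset.mul_sum, ← Finset.mul_sum,
      Finset.sum_ite_eq', if_pos (by simp)]
    rfl
  have hO : psum o n = 1 / 2 * psum (conv d e) n + 1 / 2 * psum (conv g o) n := by
    have : psum o n = ∑ k ∈ Finset.range (n + 1), (1 / 2 * conv d e k + 1 / 2 * conv g o k) :=
      Finset.sum_congr rfl fun k _ => hoe k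
    rw [this, Finset.sum_add_distrib, ← Finset.mul_sum, ← Finset.mul_sum]
    rfl
  have hle : ∀ a b : ℕ → ℝ, (∀ k, 0 ≤ a k) → (∀ k, 0 ≤ b k) → (∀ k, psum a k ≤ 1) →
      psum (conv a b) n ≤ psum b n := fun a b ha hb ha1 =>
    (psum_conv_le ha hb n).trans (mul_le_of_le_one_left (psum_nonneg hb n) (ha1 n))
  have hV : psum v n = psum e n - psum o n := by
    simp only [psum, ← Finset.sum_sub_distrib]
    exact Finset.sum_congr rfl fun k _ => by simp only [he, ho]; ring
  -- With E and O the two partial sums, these bounds yield E ≤ 1 + O/2 + E/2 and O ≤ E/2 + O/2, that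
  -- is 0 ≤ E - O ≤ 2.
  have h1 := hle d o hd0 ho0 hd1
  have h2 := hle g e hg he0 hg1
  have h3 := hle d e hd0 he0 hd1
  have h4 := hle g o hg ho0 hg1
  rw [hV]
  constructor <;> linarith

/-- The sign is multiplicative, so the alternating version of u * u is v * v with v_k = (-1)^k u_k.
Its partial sum is v convolved with the partial sums of v, which lie in [0, 2]. The gain is one
whole factor U_n over the unsigned sum. -/
theorem abs_psum_alternating_conv_le (h : RenewalSeq f r u) {g : ℕ → ℝ} (hg : ∀ n, 0 ≤ g n)
    (hg1 : ∀ n, psum g n ≤ 1) (hodd : ∀ n, ¬ Even n → g n = 0)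
    (hf : ∀ n, f n = 1 / 2 * (if n = 1 then 1 else 0) + 1 / 2 * g n) (n : ℕ) :
    |psum (fun k => (-1) ^ k * conv u u k) n| ≤ 2 * psum u n := by
  set v : ℕ → ℝ := fun k => (-1) ^ k * u k with hv
  have h1 : (fun k => (-1) ^ k * conv u u k) = conv v v := by
    ext k
    simp only [conv, Finset.mul_sum]
    refine Finset.sum_congr rfl fun z hz => ?_
    rw [Finset.HasAntidiagonal.mem_antidiagonal] at hz
    simp only [hv]
    rw [← hz, pow_add]
    ring
  rw [h1, psum_conv, conv_eq_range, psum, Finset.mul_sum]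
  refine (Finset.abs_sum_le_sum_abs _ _).trans (Finset.sum_le_sum fun k _ => ?_)
  have h2 := h.psum_alternating_mem hg hg1 hodd hf (n - k)
  rw [abs_mul, abs_of_nonneg h2.1]
  have h3 : |v k| = u k := by
    simp only [hv]
    rw [abs_mul, abs_pow, abs_neg, abs_one, one_pow, one_mul, abs_of_nonneg (h.u_nonneg k)]
  rw [h3, mul_comm]
  exact mul_le_mul_of_nonneg_right h2.2 (h.u_nonneg k)

end RenewalSeq

/-! ### Tails of laws `s` with `n * s n` slowly varying. -/

/-- `ρ` is the tail of `s`, and `n * s n` is slowly varying. -/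
structure SlowTail (s ρ : ℕ → ℝ) : Prop where
  nonneg : ∀ n, 0 ≤ s n
  tail_nonneg : ∀ n, 0 ≤ ρ n
  sub : ∀ n, ρ n - ρ (n + 1) = s (n + 1)
  tendsto : Tendsto ρ atTop (𝓝 0)
  slow : UnifSlow (fun n => n * s n)

namespace SlowTail

variable {s ρ : ℕ → ℝ}

theorem antitone (h : SlowTail s ρ) : Antitone ρ :=
  antitone_nat_of_succ_le fun n => by linarith [h.sub n, h.nonneg (n + 1)]

theorem sub_eq_sum (h : SlowTail s ρ) {a b : ℕ} (hab : a ≤ b) :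
    ρ a - ρ b = ∑ m ∈ Finset.Ico (a + 1) (b + 1), s m := by
  induction b, hab using Nat.le_induction with
  | base => simp
  | succ b hb ih =>
    rw [Finset.sum_Ico_succ_top (by omega), ← ih, ← h.sub b]
    ring

/-- With p(n) = n s(n), the block (n, 2n] contributes at least p(n)/4 to ρ(n). Since p(2n) ≥ (1 -
1/(j+2)) p(n), passing from 2n to n loses at most p(n)/8 from the bound (j/8) p(2n), so the
coefficient grows by at least 1/8. As j is arbitrary, p = o(ρ). -/
theorem mul_le_tail (h : SlowTail s ρ) (j : ℕ) :
    ∀ᶠ n : ℕ in atTop, (j / 8 : ℝ) * (n * s n) ≤ ρ n := by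
  induction j with
  | zero => exact Eventually.of_forall fun n => by simpa using h.tail_nonneg n
  | succ j ih =>
    obtain ⟨N, hN⟩ := h.slow.bounds 2 (show (0 : ℝ) < 1 / (j + 2) by positivity)
    have h2 : Tendsto (fun n : ℕ => 2 * n) atTop atTop :=
      tendsto_id.const_mul_atTop' (by norm_num)
    filter_upwards [h2.eventually ih, eventually_ge_atTop (N + 1)] with n h1 hn
    have hn0 : (0 : ℝ) < n := by exact_mod_cast (by omega)
    obtain ⟨-, hp, h3⟩ := hN (2 * n) n (by omega) (by omega) (by omega) (by omega)
    set p : ℕ → ℝ := fun n => n * s n with hpdef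
    change _ * p _ ≤ _ at h1
    change _ * p _ ≤ _
    change 0 < p n at hp
    change |p (2 * n) - p n| ≤ _ * p n at h3
    have hj : (1 : ℝ) / (j + 2) ≤ 1 / 2 := by
      apply one_div_le_one_div_of_le <;> norm_num
    have hsum : p n / 4 ≤ ρ n - ρ (2 * n) := by
      rw [h.sub_eq_sum (by omega)]
      have h4 : ∀ m ∈ Finset.Ico (n + 1) (2 * n + 1), p n / (4 * n) ≤ s m := by
        intro m hm
        rw [Finset.mem_Ico] at hm
        have h5 := (hN m n (by omega) (by omega) (by omega) (by omega)).2.2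
        change |p m - p n| ≤ _ * p n at h5
        have h6 : 1 / (j + 2 : ℝ) * p n ≤ 1 / 2 * p n := by gcongr
        have h7 : p n / 2 ≤ p m := by linarith [(abs_le.1 h5).1]
        have hm' : (m : ℝ) ≤ 2 * n := by exact_mod_cast (by omega)
        have h8 : p m ≤ 2 * n * s m := mul_le_mul_of_nonneg_right hm' (h.nonneg m)
        rw [div_le_iff₀ (by positivity)]
        linarith
      have h9 := Finset.card_nsmul_le_sum _ _ _ h4
      rw [Nat.card_Ico, nsmul_eq_mul, show 2 * n + 1 - (n + 1) = n by omega] at h9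
      refine le_trans (le_of_eq ?_) h9
      field_simp
    have h10 : (1 - 1 / (j + 2 : ℝ)) * p n ≤ p (2 * n) := by linarith [(abs_le.1 h3).1]
    have h11 : (j / 8 : ℝ) * ((1 - 1 / (j + 2 : ℝ)) * p n) ≤ (j / 8 : ℝ) * p (2 * n) := by gcongr
    have h12 : (j : ℝ) * (1 / (j + 2)) ≤ 1 := by
      rw [mul_one_div, div_le_one (by positivity)]; linarith
    have h13 := mul_le_mul_of_nonneg_right h12 hp.le
    push_cast
    linarith

theorem tail_pos (h : SlowTail s ρ) (n : ℕ) : 0 < ρ n := by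
  obtain ⟨m, h1, h2, h3⟩ := ((h.mul_le_tail 1).and
    (h.slow.pos.and (eventually_ge_atTop n))).exists
  refine lt_of_lt_of_le ?_ (h.antitone h3)
  refine lt_of_lt_of_le ?_ h1
  push_cast
  linarith

theorem tendsto_div_tail (h : SlowTail s ρ) :
    Tendsto (fun n : ℕ => n * s n / ρ n) atTop (𝓝 0) := by
  rw [Metric.tendsto_nhds]
  intro ε hε
  obtain ⟨j, hj⟩ := exists_nat_gt (8 / ε)
  filter_upwards [h.mul_le_tail j, h.slow.pos] with n h1 h2
  have h3 := h.tail_pos n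
  have hj0 : (0 : ℝ) < j := lt_trans (by positivity) hj
  rw [Real.dist_eq, sub_zero, abs_of_pos (div_pos h2 h3), div_lt_iff₀ h3]
  rw [div_lt_iff₀ hε] at hj
  have h4 := mul_lt_mul_of_pos_right hj h2
  have h5 := mul_le_mul_of_nonneg_left h1 hε.le
  linarith

/-- For q ≤ p ≤ K q, the mass of (q, p] is at most 2K q s(q), which is o(ρ(q)). -/
theorem unifSlow_tail (h : SlowTail s ρ) : UnifSlow ρ := by
  refine UnifSlow.of_le (Eventually.of_forall h.tail_pos) fun K ε hε => ?_
  obtain ⟨N, hN⟩ := h.slow.bounds (K + 1) one_pos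
  have h1 := h.tendsto_div_tail.eventually
    (gt_mem_nhds (show (0 : ℝ) < ε / (2 * K + 1) by positivity))
  obtain ⟨N', hN'⟩ := eventually_atTop.1 h1
  refine ⟨N + N' + 1, fun p q hq hqp hpq => ?_⟩
  have hq0 : (0 : ℝ) < q := by exact_mod_cast (by omega)
  have hρ := h.tail_pos q
  have h2 := hN' q (by omega)
  rw [div_lt_iff₀ hρ] at h2
  have hps : 0 < q * s q := (hN q q (by omega) (by omega) (by nlinarith) (by nlinarith)).1
  have h3 : ρ q - ρ p ≤ 2 * K * (q * s q) := by
    rw [h.sub_eq_sum hqp]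
    have h4 : ∀ m ∈ Finset.Ico (q + 1) (p + 1), s m ≤ 2 * s q := by
      intro m hm
      rw [Finset.mem_Ico] at hm
      have h5 := (hN m q (by omega) (by omega) (by nlinarith) (by nlinarith)).2.2
      have h6 : m * s m ≤ 2 * (q * s q) := by linarith [(abs_le.1 h5).2]
      have h7 : (q : ℝ) * s m ≤ m * s m :=
        mul_le_mul_of_nonneg_right (by exact_mod_cast (by omega)) (h.nonneg m)
      refine le_of_mul_le_mul_left (le_trans h7 (h6.trans (le_of_eq ?_))) hq0
      ring
    refine (Finset.sum_le_card_nsmul _ _ _ h4).trans ?_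
    rw [nsmul_eq_mul, Nat.card_Ico]
    have h8 : ((p + 1 - (q + 1) : ℕ) : ℝ) ≤ K * q := by exact_mod_cast (by omega)
    have h9 : 0 ≤ s q := h.nonneg q
    calc _ ≤ (K * q : ℝ) * (2 * s q) := by gcongr
      _ = _ := by ring
  have h10 : 2 * K * (q * s q) < ε * ρ q := by
    have hK : (0 : ℝ) < 2 * K + 1 := by positivity
    have : (2 * K + 1) * (q * s q) < (2 * K + 1) * (ε / (2 * K + 1) * ρ q) := by gcongr
    rw [show (2 * K + 1) * (ε / (2 * K + 1) * ρ q) = ε * ρ q by field_simp] at this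
    linarith
  have h11 := h.antitone hqp
  rw [div_sub_one hρ.ne', abs_div, abs_of_pos hρ, div_lt_iff₀ hρ, abs_lt]
  constructor <;> linarith

/-- Truncated first moments are negligible. -/
theorem tendsto_psum_div (h : SlowTail s ρ) :
    Tendsto (fun n : ℕ => psum (fun m => m * s m) n / (n * ρ n)) atTop (𝓝 0) := by
  obtain ⟨C, hC, hle⟩ := h.slow.exists_sum_le
  have h1 := h.tendsto_div_tail.const_mul C
  rw [mul_zero] at h1
  refine tendsto_of_tendsto_of_tendsto_of_le_of_le' tendsto_const_nhds h1 ?_ ?_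
  · refine Eventually.of_forall fun n => div_nonneg (psum_nonneg (fun m => ?_) n) ?_
    · exact mul_nonneg (Nat.cast_nonneg _) (h.nonneg m)
    · exact mul_nonneg (Nat.cast_nonneg _) (h.tail_nonneg n)
  · filter_upwards [hle, eventually_gt_atTop 0] with n h2 h3
    have hn : (0 : ℝ) < n := by exact_mod_cast h3
    have hρ := h.tail_pos n
    rw [div_le_iff₀ (by positivity)]
    refine h2.trans (le_of_eq ?_)
    field_simp

/-- The truncated first moment is o(n ρ(n)) yet stays above a positive constant. -/
theorem tendsto_mul_tail (h : SlowTail s ρ) :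
    Tendsto (fun n : ℕ => n * ρ n) atTop atTop := by
  have hpos : ∀ᶠ n : ℕ in atTop, 0 < psum (fun m => m * s m) n := by
    obtain ⟨m, hm⟩ := h.slow.pos.exists
    filter_upwards [eventually_ge_atTop m] with n hn
    refine lt_of_lt_of_le hm (Finset.single_le_sum (f := fun m : ℕ => (m : ℝ) * s m)
      (fun i _ => mul_nonneg (Nat.cast_nonneg _) (h.nonneg i)) (Finset.mem_range.2 (by omega)))
  obtain ⟨m, hm⟩ := hpos.exists
  have h1 : Tendsto (fun n : ℕ => psum (fun m => m * s m) n / (n * ρ n)) atTop (𝓝[>] 0) := by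
    refine tendsto_nhdsWithin_iff.2 ⟨h.tendsto_psum_div, ?_⟩
    filter_upwards [hpos, eventually_gt_atTop 0] with n h2 h3
    have hn : (0 : ℝ) < n := by exact_mod_cast h3
    exact div_pos h2 (mul_pos hn (h.tail_pos n))
  have h2 := (tendsto_inv_nhdsGT_zero.comp h1).const_mul_atTop hm
  refine tendsto_atTop_mono' _ ?_ h2
  filter_upwards [hpos, eventually_ge_atTop m] with n h3 h4
  simp only [Function.comp]
  have h5 : psum (fun m => m * s m) m ≤ psum (fun m => m * s m) n :=
    psum_mono (fun i => mul_nonneg (Nat.cast_nonneg i) (h.nonneg i)) h4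
  rw [inv_div, mul_div_assoc', div_le_iff₀ h3, mul_comm]
  exact mul_le_mul_of_nonneg_left h5 (mul_nonneg (Nat.cast_nonneg _) (h.tail_nonneg n))

end SlowTail

/-! ### Asymptotics of the renewal mass of the mixture. -/

/-- The renewal sequence of the mixture `f` of the point mass at `1` and of the law `g` of twice
a variable with law `s`. -/
structure LazyDouble (s ρ g f r u : ℕ → ℝ) : Prop where
  tail : SlowTail s ρ
  renewal : RenewalSeq f r u
  g_nonneg : ∀ n, 0 ≤ g n
  psum_g_le : ∀ n, psum g n ≤ 1
  g_even : ∀ m, g (2 * m) = s m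
  g_odd : ∀ n, ¬ Even n → g n = 0
  f_eq : ∀ n, f n = 1 / 2 * (if n = 1 then 1 else 0) + 1 / 2 * g n
  r_eq : ∀ n, 1 ≤ n → r n = 1 / 2 * ρ (n / 2)

theorem tendsto_div_two_atTop : Tendsto (fun n : ℕ => n / 2) atTop atTop :=
  Nat.tendsto_div_const_atTop (by norm_num)

namespace LazyDouble

variable {s ρ g f r u : ℕ → ℝ}

theorem tendsto_tail_div (h : LazyDouble s ρ g f r u) :
    Tendsto (fun n => r n / (1 / 2 * ρ n)) atTop (𝓝 1) := by
  have h1 := h.tail.unifSlow_tail.ratio 3 tendsto_div_two_atTop tendsto_id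
    (by filter_upwards [eventually_ge_atTop 2] with n hn
        simp only [id]; omega)
  refine h1.congr' ?_
  filter_upwards [eventually_ge_atTop 1] with n hn
  rw [h.r_eq n hn, mul_div_mul_left _ _ (by norm_num)]
  rfl

theorem unifSlow_r (h : LazyDouble s ρ g f r u) : UnifSlow r :=
  ((UnifSlow.const (c := 1 / 2) (by norm_num)).mul h.tail.unifSlow_tail).congr h.tendsto_tail_div

theorem r_pos (h : LazyDouble s ρ g f r u) (n : ℕ) : 0 < r n := by
  rcases Nat.eq_zero_or_pos n with rfl | hn
  · rw [h.renewal.r_zero]; exact one_pos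
  · rw [h.r_eq n hn]
    have := h.tail.tail_pos (n / 2)
    positivity

theorem tendsto_r (h : LazyDouble s ρ g f r u) : Tendsto r atTop (𝓝 0) := by
  have h1 := (h.tail.tendsto.comp tendsto_div_two_atTop).const_mul (1 / 2 : ℝ)
  rw [mul_zero] at h1
  refine h1.congr' ?_
  filter_upwards [eventually_ge_atTop 1] with n hn
  rw [h.r_eq n hn]
  rfl

/-- The weights `j * f j`. -/
theorem mul_f_eq (h : LazyDouble s ρ g f r u) (j : ℕ) :
    (j : ℝ) * f j = 1 / 2 * (if j = 1 then 1 else 0) +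
      if Even j then ((j / 2 : ℕ) : ℝ) * s (j / 2) else 0 := by
  rw [h.f_eq]
  split_ifs with h1 h2 h2
  · exact absurd h2 (by rw [h1]; decide)
  · rw [h.g_odd _ h2, h1]; norm_num
  · obtain ⟨m, rfl⟩ := h2
    rw [← two_mul, h.g_even, Nat.mul_div_cancel_left _ (by norm_num)]
    push_cast; ring
  · rw [h.g_odd _ h2]; ring

theorem psum_mul_f_le (h : LazyDouble s ρ g f r u) (n : ℕ) :
    psum (fun j => j * f j) n ≤ 1 / 2 + psum (fun m => m * s m) n := by
  have hnn : ∀ j : ℕ, 0 ≤ (j : ℝ) * f j := fun j =>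
    mul_nonneg (Nat.cast_nonneg j) (h.renewal.f_nonneg j)
  -- The term 1/2 is the atom at 1; the atom of `f` at 2m has weight 2m · s(m)/2 = m s(m).
  have h1 : psum (fun j => j * f j) (2 * n + 1) = 1 / 2 + psum (fun m => m * s m) n := by
    induction n with
    | zero =>
      rw [psum_succ, psum_zero, psum_zero]
      simp only [h.mul_f_eq]
      norm_num
    | succ n ih =>
      rw [show 2 * (n + 1) + 1 = 2 * n + 1 + 1 + 1 by ring, psum_succ, psum_succ, ih, psum_succ]
      simp only [h.mul_f_eq]
      rw [if_neg (by omega), if_pos (by exact ⟨n + 1, by ring⟩), if_neg (by omega),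
        if_neg (by simp [parity_simps]), show (2 * n + 1 + 1) / 2 = n + 1 by omega]
      ring
  rw [← h1]
  exact psum_mono hnn (by omega)

theorem tendsto_psum_mul_f (h : LazyDouble s ρ g f r u) :
    Tendsto (fun n : ℕ => psum (fun j => j * f j) n / (n * r n)) atTop (𝓝 0) := by
  have hr1 : Tendsto (fun n => 1 / 2 * ρ n / r n) atTop (𝓝 1) := by
    simpa using h.tendsto_tail_div.inv₀ one_ne_zero
  have h1 : Tendsto (fun n : ℕ => (1 / (n * ρ n) + 2 * (psum (fun m => m * s m) n / (n * ρ n))) *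
      (1 / 2 * ρ n / r n)) atTop (𝓝 0) := by
    have h2 := h.tail.tendsto_mul_tail.inv_tendsto_atTop
    have := (h2.add (h.tail.tendsto_psum_div.const_mul 2)).mul hr1
    simpa [Function.comp_def] using this
  refine tendsto_of_tendsto_of_tendsto_of_le_of_le' tendsto_const_nhds h1 ?_ ?_
  · refine Eventually.of_forall fun n => div_nonneg (psum_nonneg (fun m => ?_) n) ?_
    · exact mul_nonneg (Nat.cast_nonneg _) (h.renewal.f_nonneg m)
    · exact mul_nonneg (Nat.cast_nonneg _) (h.renewal.r_nonneg n)
  · filter_upwards [eventually_gt_atTop 0] with n hn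
    have hn : (0 : ℝ) < n := by exact_mod_cast hn
    have hρ := h.tail.tail_pos n
    have hr := h.r_pos n
    rw [div_le_iff₀ (by positivity)]
    refine (h.psum_mul_f_le n).trans (le_of_eq ?_)
    field_simp

theorem tendsto_psum_mul_r (h : LazyDouble s ρ g f r u) :
    Tendsto (fun n => psum u n * r n) atTop (𝓝 1) :=
  h.renewal.tendsto_psum_mul_tail h.r_pos h.tendsto_psum_mul_f

theorem unifSlow_psum (h : LazyDouble s ρ g f r u) : UnifSlow (psum u) :=
  h.unifSlow_r.inv.congr (by simpa [div_eq_mul_inv] using h.tendsto_psum_mul_r)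

theorem psum_pos (h : LazyDouble s ρ g f r u) (n : ℕ) : 0 < psum u n := by
  refine lt_of_lt_of_le ?_ (psum_mono h.renewal.u_nonneg (Nat.zero_le n))
  rw [psum_zero, h.renewal.eq 0]
  simp [conv, h.renewal.f_zero]

theorem tendsto_inv_psum (h : LazyDouble s ρ g f r u) :
    Tendsto (fun n => (psum u n)⁻¹) atTop (𝓝 0) := by
  have h1 := h.tendsto_r.mul (h.tendsto_psum_mul_r.inv₀ one_ne_zero)
  simp only [inv_one, mul_one] at h1
  refine h1.congr fun n => ?_
  have := h.r_pos n
  have := h.psum_pos n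
  field_simp

/-- The double renewal function over a window of size about `n / 2`. -/
theorem tendsto_psum_conv_div (h : LazyDouble s ρ g f r u) :
    Tendsto (fun n => psum (conv u u) (n - n / 2 - 1) / psum u n ^ 2) atTop (𝓝 1) := by
  -- The window reaches about n / 2 and `le_psum_conv` halves it again; n / 8 leaves room for the
  -- roundings.
  have h0 : Tendsto (fun n : ℕ => n / 8) atTop atTop := Nat.tendsto_div_const_atTop (by norm_num)
  have h1 := (h.unifSlow_psum.ratio 16 h0 tendsto_id
    (by filter_upwards [eventually_ge_atTop 8] with n hn
        simp only [id]; omega)).pow 2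
  rw [one_pow] at h1
  refine tendsto_of_tendsto_of_tendsto_of_le_of_le' h1 tendsto_const_nhds ?_ ?_
  · filter_upwards [eventually_ge_atTop 8] with n hn
    simp only [id, div_pow]
    have h2 := le_psum_conv h.renewal.u_nonneg h.renewal.u_nonneg (n - n / 2 - 1)
    have h3 := psum_mono h.renewal.u_nonneg (show n / 8 ≤ (n - n / 2 - 1) / 2 by omega)
    have h4 := h.psum_pos (n / 8)
    gcongr
    nlinarith
  · refine Eventually.of_forall fun n => ?_
    have h2 := psum_conv_le h.renewal.u_nonneg h.renewal.u_nonneg (n - n / 2 - 1)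
    have h3 := psum_mono h.renewal.u_nonneg (show n - n / 2 - 1 ≤ n by omega)
    have h4 := h.psum_pos (n - n / 2 - 1)
    have h5 := h.psum_pos n
    rw [div_le_one (by positivity)]
    nlinarith

theorem tendsto_alternating_div (h : LazyDouble s ρ g f r u) :
    Tendsto (fun n => psum (fun k => (-1) ^ k * conv u u k) (n - n / 2 - 1) / psum u n ^ 2)
      atTop (𝓝 0) := by
  have h1 := h.tendsto_inv_psum.const_mul 2
  rw [mul_zero] at h1
  refine squeeze_zero_norm (fun n => ?_) h1
  have h2 := h.renewal.abs_psum_alternating_conv_le h.g_nonneg h.psum_g_le h.g_odd h.f_eq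
    (n - n / 2 - 1)
  have h3 := psum_mono h.renewal.u_nonneg (show n - n / 2 - 1 ≤ n by omega)
  have h4 := h.psum_pos n
  rw [Real.norm_eq_abs, abs_div, abs_of_pos (pow_pos h4 2), div_le_iff₀ (pow_pos h4 2)]
  refine (h2.trans (mul_le_mul_of_nonneg_left h3 zero_le_two)).trans (le_of_eq ?_)
  field_simp

/-- The part of `n * u n` that comes from the gaps longer than `n / 2`. -/
noncomputable def far (f u : ℕ → ℝ) (n : ℕ) : ℝ :=
  ∑ l ∈ Finset.range (n - n / 2), conv u u l * (((n - l : ℕ) : ℝ) * f (n - l))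

theorem tendsto_far_div (h : LazyDouble s ρ g f r u) :
    Tendsto (fun n : ℕ => far f u n / (n * s n * psum u n ^ 2)) atTop (𝓝 (1 / 2)) := by
  set w := conv u u with hw
  have hw0 : ∀ n, 0 ≤ w n := conv_nonneg h.renewal.u_nonneg h.renewal.u_nonneg
  set W : ℕ → ℝ := fun n => psum w (n - n / 2 - 1) with hW
  set V : ℕ → ℝ := fun n => psum (fun k => (-1) ^ k * w k) (n - n / 2 - 1) with hV
  have hmain : Tendsto (fun n : ℕ => 1 / 2 * (W n / psum u n ^ 2) +
      1 / 2 * ((-1) ^ n * (V n / psum u n ^ 2))) atTop (𝓝 (1 / 2)) := by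
    have h1 : Tendsto (fun n : ℕ => (-1) ^ n * (V n / psum u n ^ 2)) atTop (𝓝 0) := by
      refine squeeze_zero_norm (fun n => ?_) (tendsto_norm_zero.comp h.tendsto_alternating_div)
      rw [norm_mul, norm_pow, norm_neg, norm_one, one_pow, one_mul]
      rfl
    have h2 := (h.tendsto_psum_conv_div.const_mul (1 / 2)).add (h1.const_mul (1 / 2))
    rwa [mul_zero, add_zero, mul_one] at h2
  have hdiff : Tendsto (fun n : ℕ => far f u n / (n * s n * psum u n ^ 2) -
      (1 / 2 * (W n / psum u n ^ 2) + 1 / 2 * ((-1) ^ n * (V n / psum u n ^ 2)))) atTop (𝓝 0) := by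
    rw [Metric.tendsto_nhds]
    intro ε hε
    -- The half-gap (n - l) / 2 is at least about n / 4; the factor 5 absorbs the floors.
    obtain ⟨N, hN⟩ := h.tail.slow.bounds 5 (half_pos hε)
    have hW2 := h.tendsto_psum_conv_div.eventually (gt_mem_nhds (show (1 : ℝ) < 2 by norm_num))
    filter_upwards [hW2, eventually_ge_atTop (4 * N + 8)] with n h1 hn
    have hp : 0 < n * s n := (hN n n (by omega) (by omega) (by omega) (by omega)).1
    have hU := h.psum_pos n
    change W n / _ < 2 at h1
    rw [Real.dist_eq, sub_zero]
    have hterm : ∀ l ∈ Finset.range (n - n / 2),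
        |w l * (((n - l : ℕ) : ℝ) * f (n - l)) -
          (1 / 2 * (n * s n) * w l + 1 / 2 * (n * s n) * ((-1) ^ n * ((-1) ^ l * w l)))| ≤
          ε / 2 * (n * s n) * w l := by
      intro l hl
      rw [Finset.mem_range] at hl
      have hln : l ≤ n := by omega
      rw [h.mul_f_eq, if_neg (by omega), mul_zero, zero_add]
      -- The indicator that n - l is even is (1 + (-1)^n (-1)^l) / 2, which produces the plain sum
      -- `W` and the alternating sum `V`.
      have hsign : ((-1 : ℝ)) ^ n * (-1) ^ l = if Even (n - l) then 1 else -1 := by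
        rw [← pow_add]
        by_cases hc : Even (n - l)
        · rw [if_pos hc, Even.neg_one_pow (Nat.even_add.2 ((Nat.even_sub hln).1 hc))]
        · rw [if_neg hc, Odd.neg_one_pow (by
            rwa [← Nat.not_even_iff_odd, Nat.even_add, ← Nat.even_sub hln])]
      have hre : (1 / 2 * (n * s n) * w l + 1 / 2 * (n * s n) * ((-1) ^ n * ((-1) ^ l * w l))) =
          (1 / 2 + 1 / 2 * ((-1) ^ n * (-1) ^ l)) * (n * s n) * w l := by ring
      rw [hre, hsign]
      by_cases hev : Even (n - l)
      · rw [if_pos hev, if_pos hev]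
        have h3 := (hN ((n - l) / 2) n (by omega) (by omega) (by omega) (by omega)).2.2
        rw [show w l * (((n - l) / 2 : ℕ) * s ((n - l) / 2)) -
          (1 / 2 + 1 / 2 * 1) * (n * s n) * w l =
          (((n - l) / 2 : ℕ) * s ((n - l) / 2) - n * s n) * w l by ring, abs_mul,
          abs_of_nonneg (hw0 l)]
        exact mul_le_mul_of_nonneg_right h3 (hw0 l)
      · rw [if_neg hev, if_neg hev, show w l * 0 - (1 / 2 + 1 / 2 * -1) * (n * s n) * w l = 0 by
          ring, abs_zero]
        exact mul_nonneg (by positivity) (hw0 l)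
    have hsum := (Finset.abs_sum_le_sum_abs _ _).trans (Finset.sum_le_sum hterm)
    have hr' : n - n / 2 = n - n / 2 - 1 + 1 := by omega
    have hWs : ∑ l ∈ Finset.range (n - n / 2), w l = W n := by
      simp only [hW, psum]; rw [← hr']
    have hVs : ∑ l ∈ Finset.range (n - n / 2), (-1) ^ l * w l = V n := by
      simp only [hV, psum]; rw [← hr']
    rw [Finset.sum_sub_distrib, Finset.sum_add_distrib, ← Finset.mul_sum, ← Finset.mul_sum,
      ← Finset.mul_sum, ← Finset.mul_sum, hWs, hVs] at hsum
    change |far f u n - _| ≤ _ at hsum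
    have hD : 0 < n * s n * psum u n ^ 2 := by positivity
    rw [show far f u n / (n * s n * psum u n ^ 2) -
      (1 / 2 * (W n / psum u n ^ 2) + 1 / 2 * ((-1) ^ n * (V n / psum u n ^ 2))) =
      (far f u n - (1 / 2 * (n * s n) * W n + 1 / 2 * (n * s n) * ((-1) ^ n * V n))) /
        (n * s n * psum u n ^ 2) by
        have hn0 : (n : ℝ) ≠ 0 := by exact_mod_cast (by omega : n ≠ 0)
        have hs0 : s n ≠ 0 := fun hs => by simp [hs] at hp
        field_simp, abs_div, abs_of_pos hD, div_lt_iff₀ hD]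
    rw [div_lt_iff₀ (by positivity)] at h1
    have h4 : ε / 2 * (n * s n) * W n < ε / 2 * (n * s n) * (2 * psum u n ^ 2) := by gcongr
    linarith
  have := hdiff.add hmain
  simpa using this

/-- Short gaps correspond to l ≥ n / 2, where `conv_self_le` only uses u at indices k ≥ n / 4. The
restriction k < n is possible because l = n carries weight 0; it is what allows strong induction on
n. -/
theorem near_le (h : LazyDouble s ρ g f r u) {n : ℕ} {M : ℝ}
    (hM : ∀ k, n ≤ 4 * k → k < n → u k ≤ M) (hM0 : 0 ≤ M) :
    n * u n ≤ far f u n + 2 * M * psum u n * psum (fun j => j * f j) n := by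
  have hU := h.psum_pos n
  rw [h.renewal.mul_eq_conv, conv_comm, conv_eq_range, far,
    ← Finset.sum_range_add_sum_Ico _ (show n - n / 2 ≤ n + 1 by omega)]
  have hnn : ∀ j : ℕ, 0 ≤ (j : ℝ) * f j := fun j =>
    mul_nonneg (Nat.cast_nonneg j) (h.renewal.f_nonneg j)
  gcongr
  have h1 : ∀ l ∈ Finset.Ico (n - n / 2) (n + 1), conv u u l * (((n - l : ℕ) : ℝ) * f (n - l)) ≤
      2 * M * psum u n * (((n - l : ℕ) : ℝ) * f (n - l)) := by
    intro l hl
    rw [Finset.mem_Ico] at hl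
    rcases eq_or_lt_of_le (show l ≤ n by omega) with rfl | hln
    · simp
    · refine mul_le_mul_of_nonneg_right ?_ (hnn _)
      refine (conv_self_le h.renewal.u_nonneg fun k hk1 hk2 =>
        hM k (by omega) (by omega)).trans ?_
      exact mul_le_mul_of_nonneg_left (psum_mono h.renewal.u_nonneg hln.le) (by positivity)
  refine (Finset.sum_le_sum h1).trans ?_
  rw [← Finset.mul_sum]
  refine mul_le_mul_of_nonneg_left ?_ (by positivity)
  refine (Finset.sum_le_sum_of_subset_of_nonneg (t := Finset.range (n + 1)) (fun l hl => ?_)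
    fun l _ _ => hnn _).trans (le_of_eq ?_)
  · rw [Finset.mem_Ico] at hl
    exact Finset.mem_range.2 hl.2
  · have := Finset.sum_range_reflect (fun j : ℕ => (j : ℝ) * f j) (n + 1)
    simpa only [Nat.add_sub_cancel, psum] using this

theorem far_le (h : LazyDouble s ρ g f r u) (n : ℕ) : far f u n ≤ n * u n := by
  rw [h.renewal.mul_eq_conv, conv_comm, conv_eq_range, far]
  refine Finset.sum_le_sum_of_subset_of_nonneg (Finset.range_subset_range.2 (by omega))
    fun l _ _ => mul_nonneg (conv_nonneg h.renewal.u_nonneg h.renewal.u_nonneg l) ?_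
  exact mul_nonneg (Nat.cast_nonneg _) (h.renewal.f_nonneg _)

theorem unifSlow_limit (h : LazyDouble s ρ g f r u) : UnifSlow (fun n => n * s n / r n ^ 2) := by
  have := h.tail.slow.mul (h.unifSlow_r.mul h.unifSlow_r).inv
  simpa [div_eq_mul_inv, sq] using this

theorem tendsto_far_div_limit (h : LazyDouble s ρ g f r u) :
    Tendsto (fun n : ℕ => far f u n / (n * s n / r n ^ 2)) atTop (𝓝 (1 / 2)) := by
  have h1 := h.tendsto_far_div.mul (h.tendsto_psum_mul_r.pow 2)
  simp only [one_pow, mul_one] at h1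
  refine h1.congr fun n => ?_
  have := h.r_pos n
  have := h.psum_pos n
  rw [div_mul_eq_mul_div, div_div_eq_mul_div, show far f u n * (psum u n * r n) ^ 2 =
    far f u n * r n ^ 2 * psum u n ^ 2 by ring, mul_div_mul_right _ _ (by positivity)]

theorem tendsto_near (h : LazyDouble s ρ g f r u) :
    Tendsto (fun n : ℕ => psum u n * psum (fun j => j * f j) n / n) atTop (𝓝 0) := by
  have h1 := h.tendsto_psum_mul_r.mul h.tendsto_psum_mul_f
  rw [mul_zero] at h1
  refine h1.congr fun n => ?_
  have := h.r_pos n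
  rcases eq_or_ne (n : ℝ) 0 with hn | hn
  · simp [hn]
  · field_simp

/-- A priori bound of the right order by strong induction: `near_le` returns the inductive constant
multiplied by a factor tending to 0. -/
theorem exists_bound (h : LazyDouble s ρ g f r u) :
    ∃ B, 0 < B ∧ ∀ᶠ n : ℕ in atTop, n * u n ≤ B * (n * s n / r n ^ 2) := by
  set G : ℕ → ℝ := fun n => n * s n / r n ^ 2 with hG
  obtain ⟨N₁, hN₁⟩ := h.unifSlow_limit.bounds 4 one_pos
  obtain ⟨N₂, hN₂⟩ := eventually_atTop.1
    (h.tendsto_far_div_limit.eventually (gt_mem_nhds (show (1 / 2 : ℝ) < 1 by norm_num)))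
  obtain ⟨N₃, hN₃⟩ := eventually_atTop.1
    (h.tendsto_near.eventually (gt_mem_nhds (show (0 : ℝ) < 1 / 32 by norm_num)))
  set N := N₁ + N₂ + N₃ + 1 with hN
  have hpos : ∀ n, N ≤ n → 0 < G n := fun n hn =>
    (hN₁ n n (by omega) (by omega) (by omega) (by omega)).1
  set B : ℝ := ∑ n ∈ Finset.range (4 * N), |n * u n / G n| with hB
  have hB0 : 0 ≤ B := Finset.sum_nonneg fun _ _ => abs_nonneg _
  -- `B` covers n < 4N. For k in [n/4, n), G k ≤ 2 G n and n ≤ 4k give u_k ≤ 8 (B + 2) G n / n. The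
  -- short part is then at most 16 (B + 2) / 32 · G n and the long part at most G n, in total (B/2 +
  -- 2) G n.
  refine ⟨B + 2, by positivity, eventually_atTop.2 ⟨N, fun n => ?_⟩⟩
  induction n using Nat.strong_induction_on with
  | _ n ih =>
    intro hn
    have hGn := hpos n hn
    have hn0 : (0 : ℝ) < n := by exact_mod_cast (by omega : 0 < n)
    change _ ≤ _ * G n
    rcases lt_or_ge n (4 * N) with hlt | hge
    · have h1 : |n * u n / G n| ≤ B :=
        Finset.single_le_sum (f := fun n : ℕ => |n * u n / G n|) (fun _ _ => abs_nonneg _)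
          (Finset.mem_range.2 hlt)
      have h2 := (le_abs_self _).trans h1
      rw [div_le_iff₀ hGn] at h2
      linarith
    · have hM : ∀ k, n ≤ 4 * k → k < n → u k ≤ 8 * (B + 2) * G n / n := by
        intro k hk1 hk2
        have h1 := ih k hk2 (by omega)
        have h2 := (hN₁ k n (by omega) (by omega) (by omega) (by omega)).2.2
        change |G k - G n| ≤ _ * G n at h2
        change _ ≤ _ * G k at h1
        have h3 : G k ≤ 2 * G n := by linarith [(abs_le.1 h2).2]
        have h4 : (n : ℝ) ≤ 4 * k := by exact_mod_cast hk1
        have h5 := mul_le_mul_of_nonneg_right h4 (h.renewal.u_nonneg k)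
        have h6 : (B + 2) * G k ≤ (B + 2) * (2 * G n) := by gcongr
        rw [le_div_iff₀ hn0]
        linarith
      have h1 := h.near_le hM (by positivity)
      have h2 := hN₂ n (by omega)
      change _ / G n < 1 at h2
      rw [div_lt_one hGn] at h2
      have h3 := hN₃ n (by omega)
      have h4 : 2 * (8 * (B + 2) * G n / n) * psum u n * psum (fun j => j * f j) n =
          16 * (B + 2) * G n * (psum u n * psum (fun j => j * f j) n / n) := by ring
      have h5 : 16 * (B + 2) * G n * (psum u n * psum (fun j => j * f j) n / n) ≤
          16 * (B + 2) * G n * (1 / 32) := by gcongr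
      rw [h4] at h1
      have : 0 ≤ B * G n := by positivity
      linarith

/-- The long part is a lower bound by `far_le`. Once `exists_bound` is available, `near_le` shows
that the remainder is negligible. -/
theorem tendsto_mul_u_div (h : LazyDouble s ρ g f r u) :
    Tendsto (fun n : ℕ => n * u n / (n * s n / r n ^ 2)) atTop (𝓝 (1 / 2)) := by
  set G : ℕ → ℝ := fun n => n * s n / r n ^ 2 with hG
  obtain ⟨B, hB, hle⟩ := h.exists_bound
  obtain ⟨N₀, hN₀⟩ := eventually_atTop.1 hle
  obtain ⟨N₁, hN₁⟩ := h.unifSlow_limit.bounds 4 one_pos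
  have h1 : Tendsto (fun n : ℕ => far f u n / G n +
      16 * B * (psum u n * psum (fun j => j * f j) n / n)) atTop (𝓝 (1 / 2)) := by
    simpa using h.tendsto_far_div_limit.add (h.tendsto_near.const_mul (16 * B))
  refine tendsto_of_tendsto_of_tendsto_of_le_of_le' h.tendsto_far_div_limit h1 ?_ ?_
  · filter_upwards [eventually_ge_atTop N₁] with n hn
    have hGn : 0 < G n := (hN₁ n n (by omega) (by omega) (by omega) (by omega)).1
    exact div_le_div_of_nonneg_right (h.far_le n) hGn.le
  · filter_upwards [eventually_ge_atTop (4 * (N₀ + N₁ + 1))] with n hn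
    have hGn : 0 < G n := (hN₁ n n (by omega) (by omega) (by omega) (by omega)).1
    have hn0 : (0 : ℝ) < n := by exact_mod_cast (by omega : 0 < n)
    have hM : ∀ k, n ≤ 4 * k → k < n → u k ≤ 8 * B * G n / n := by
      intro k hk1 hk2
      have h1 := hN₀ k (by omega)
      have h2 := (hN₁ k n (by omega) (by omega) (by omega) (by omega)).2.2
      change |G k - G n| ≤ _ * G n at h2
      change _ ≤ _ * G k at h1
      have h3 : G k ≤ 2 * G n := by linarith [(abs_le.1 h2).2]
      have h4 : (n : ℝ) ≤ 4 * k := by exact_mod_cast hk1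
      have h5 := mul_le_mul_of_nonneg_right h4 (h.renewal.u_nonneg k)
      have h6 : B * G k ≤ B * (2 * G n) := by gcongr
      rw [le_div_iff₀ hn0]
      linarith
    have h2 := h.near_le hM (by positivity)
    rw [div_le_iff₀ hGn, add_mul, div_mul_cancel₀ _ hGn.ne']
    refine h2.trans (le_of_eq ?_)
    ring

end LazyDouble

/-! ### From the process to the renewal equation. -/

section Tail

variable {Ω : Type*} [MeasurableSpace Ω] {P : Measure Ω} [IsProbabilityMeasure P] {X : Ω → ℕ}

theorem measureReal_tail_sub (hX : Measurable X) (n : ℕ) :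
    P.real {ω | n < X ω} - P.real {ω | n + 1 < X ω} = P.real {ω | X ω = n + 1} := by
  have h1 : {ω | n < X ω} = {ω | n + 1 < X ω} ∪ {ω | X ω = n + 1} := by
    ext ω
    simp only [Set.mem_ofPred_eq, Set.mem_union]
    omega
  have h2 : Disjoint {ω | n + 1 < X ω} {ω | X ω = n + 1} := by
    rw [Set.disjoint_left]
    intro ω h3 h4
    simp only [Set.mem_ofPred_eq] at h3 h4
    omega
  rw [h1, measureReal_union h2 (hX (measurableSet_singleton (n + 1)))]
  ring

theorem psum_measureReal (hX : Measurable X) (n : ℕ) :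
    psum (fun k => P.real {ω | X ω = k}) n = 1 - P.real {ω | n < X ω} := by
  induction n with
  | zero =>
    rw [psum_zero]
    have h1 := probReal_compl_eq_one_sub (μ := P) (hX (measurableSet_Ioi (a := 0)))
    refine Eq.trans ?_ h1
    congr 1
    ext ω
    simp
  | succ n ih =>
    rw [psum_succ, ih, ← measureReal_tail_sub hX]
    ring

theorem tendsto_measureReal_tail (hX : Measurable X) :
    Tendsto (fun n => P.real {ω | n < X ω}) atTop (𝓝 0) := by
  have h1 := tendsto_measure_iInter_atTop (μ := P) (s := fun n : ℕ => {ω | n < X ω})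
    (fun n => (hX (measurableSet_Ioi (a := n))).nullMeasurableSet)
    (fun m n hmn ω (hω : n < X ω) => lt_of_le_of_lt hmn hω) ⟨0, measure_ne_top _ _⟩
  have h2 : ⋂ n : ℕ, {ω | n < X ω} = ∅ := by
    ext ω
    simp only [Set.mem_iInter, Set.mem_ofPred_eq, Set.mem_empty_iff_false, iff_false, not_forall]
    exact ⟨X ω, lt_irrefl _⟩
  rw [h2, measure_empty] at h1
  exact (ENNReal.tendsto_toReal ENNReal.zero_ne_top).comp h1

end Tail

namespace IsRecurrentRenewal

variable {Ω : Type*} [MeasurableSpace Ω] {P : Measure Ω} {τ : ℕ → Ω → ℕ}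

/-- Almost surely τ_k is the sum of the first k gaps, which are jointly independent of the next one.
-/
theorem indepFun_gap (h : IsRecurrentRenewal P τ) (k : ℕ) :
    IndepFun (fun ω => τ (k + 1) ω - τ k ω) (τ k) P := by
  have h1 := (h.indep.indepFun_finsetSum_of_notMem
    (fun i => (h.measurable (i + 1)).sub (h.measurable i))
    (Finset.notMem_range_self (n := k))).symm
  refine h1.congr (ae_eq_refl _) ?_
  filter_upwards [h.strictMono, h.zero] with ω h2 h3
  rw [Finset.sum_apply, Finset.sum_range_tsub h2.monotone, h3, Nat.sub_zero]

variable [IsProbabilityMeasure P]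

/-- Strict monotonicity forces τ_k ≥ k, so any cutoff beyond n gives the same sum, and the events
are almost surely disjoint. The free cutoff makes the index shift in the renewal equation possible.
-/
theorem renewalMass_eq_sum (h : IsRecurrentRenewal P τ) {n K : ℕ} (hK : n < K) :
    renewalMass P τ n = ∑ k ∈ Finset.range K, P.real {ω | τ k ω = n} := by
  have h1 : {ω | n ∈ Set.range (fun k => τ k ω)} =ᵐ[P]
      ⋃ k ∈ Finset.range K, {ω | τ k ω = n} := by
    filter_upwards [h.strictMono] with ω h2
    refine propext ?_
    change (n ∈ Set.range (fun k => τ k ω)) ↔ ω ∈ ⋃ k ∈ Finset.range K, {ω | τ k ω = n}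
    simp only [Set.mem_range, Set.mem_iUnion, Finset.mem_range, Set.mem_ofPred_eq, exists_prop]
    constructor
    · rintro ⟨k, hk⟩
      exact ⟨k, lt_of_le_of_lt (h2.id_le k) (by simpa [hk] using hK), hk⟩
    · rintro ⟨k, -, hk⟩
      exact ⟨k, hk⟩
  rw [renewalMass, measureReal_congr h1, measureReal_biUnion_finset₀]
  · intro i _ j _ hij
    change P ({ω | τ i ω = n} ∩ {ω | τ j ω = n}) = 0
    refine measure_mono_null (fun ω hω => ?_) h.strictMono
    intro hs
    exact hij (hs.injective (hω.1.trans hω.2.symm))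
  · intro k _
    exact (h.measurable k (measurableSet_singleton n)).nullMeasurableSet

theorem measureReal_succ (h : IsRecurrentRenewal P τ) (k n : ℕ) :
    P.real {ω | τ (k + 1) ω = n} =
      conv (interarrival P τ) (fun n => P.real {ω | τ k ω = n}) n := by
  have h1 : {ω | τ (k + 1) ω = n} =ᵐ[P] ⋃ z ∈ Finset.HasAntidiagonal.antidiagonal n,
      ((fun ω => τ (k + 1) ω - τ k ω) ⁻¹' {z.1} ∩ τ k ⁻¹' {z.2}) := by
    filter_upwards [h.strictMono] with ω h2
    refine propext ?_
    have h3 := h2 (Nat.lt_succ_self k)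
    simp only [Nat.succ_eq_add_one] at h3
    change τ (k + 1) ω = n ↔ ω ∈ ⋃ z ∈ Finset.HasAntidiagonal.antidiagonal n,
      ((fun ω => τ (k + 1) ω - τ k ω) ⁻¹' {z.1} ∩ τ k ⁻¹' {z.2})
    simp only [Set.mem_iUnion, Finset.HasAntidiagonal.mem_antidiagonal, Set.mem_inter_iff,
      Set.mem_preimage, Set.mem_singleton_iff, exists_prop, Prod.exists]
    constructor
    · intro h4
      exact ⟨_, _, by omega, rfl, rfl⟩
    · rintro ⟨i, j, h4, h5, h6⟩
      omega
  have hgap : Measurable fun ω => τ (k + 1) ω - τ k ω :=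
    (h.measurable (k + 1)).sub (h.measurable k)
  rw [measureReal_congr h1, measureReal_biUnion_finset, conv]
  · refine Finset.sum_congr rfl fun z _ => ?_
    rw [measureReal_def, (h.indepFun_gap k).measure_inter_preimage_eq_mul _ _
      (measurableSet_singleton _) (measurableSet_singleton _), ENNReal.toReal_mul,
      (h.identDistrib k).measure_mem_eq (measurableSet_singleton _)]
    rfl
  · intro z _ z' _ hzz
    rw [Function.onFun, Set.disjoint_left]
    rintro ω ⟨h2, h3⟩ ⟨h4, h5⟩
    simp only [Set.mem_preimage, Set.mem_singleton_iff] at h2 h3 h4 h5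
    exact hzz (Prod.ext (h2.symm.trans h4) (h3.symm.trans h5))
  · intro z _
    exact (hgap (measurableSet_singleton _)).inter (h.measurable k (measurableSet_singleton _))

theorem tail_zero (h : IsRecurrentRenewal P τ) : interarrivalTail P τ 0 = 1 := by
  have h1 : {ω | 0 < τ 1 ω} =ᵐ[P] Set.univ := by
    filter_upwards [h.strictMono] with ω h2
    refine propext (iff_of_true ?_ trivial)
    exact lt_of_le_of_lt (Nat.zero_le _) (h2 (Nat.zero_lt_one))
  rw [interarrivalTail, measureReal_congr h1, probReal_univ]

theorem interarrival_zero (h : IsRecurrentRenewal P τ) : interarrival P τ 0 = 0 := by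
  have h1 := psum_measureReal (P := P) (h.measurable 1) 0
  rw [psum_zero] at h1
  have h2 := h.tail_zero
  rw [interarrivalTail] at h2
  rw [interarrival, h1, h2, sub_self]

theorem renewalSeq (h : IsRecurrentRenewal P τ) :
    RenewalSeq (interarrival P τ) (interarrivalTail P τ) (renewalMass P τ) where
  f_nonneg _ := measureReal_nonneg
  u_nonneg _ := measureReal_nonneg
  r_nonneg _ := measureReal_nonneg
  r_zero := h.tail_zero
  f_zero := h.interarrival_zero
  r_sub n := measureReal_tail_sub (h.measurable 1) n
  eq n := by
    have h0 : P.real {ω | τ 0 ω = n} = if n = 0 then 1 else 0 := by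
      have h1 : {ω | τ 0 ω = n} =ᵐ[P] (if n = 0 then Set.univ else ∅ : Set Ω) := by
        filter_upwards [h.zero] with ω h2
        refine propext ?_
        change τ 0 ω = n ↔ ω ∈ (if n = 0 then Set.univ else ∅ : Set Ω)
        rw [h2]
        split_ifs with hn
        · simp [hn]
        · simpa using Ne.symm hn
      rw [measureReal_congr h1]
      split_ifs <;> simp
    rw [h.renewalMass_eq_sum (show n < n + 1 + 1 by omega), Finset.sum_range_succ', h0, add_comm]
    congr 1
    simp only [h.measureReal_succ, conv]
    rw [Finset.sum_comm]
    refine Finset.sum_congr rfl fun z hz => ?_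
    rw [Finset.HasAntidiagonal.mem_antidiagonal] at hz
    rw [h.renewalMass_eq_sum (show z.2 < n + 1 by omega), Finset.mul_sum]

end IsRecurrentRenewal

/-! ### The example for an arbitrary admissible σ. -/

section Mixture

variable {Ω Ω' : Type*} [MeasurableSpace Ω] [MeasurableSpace Ω']
  {Q : Measure Ω'} [IsProbabilityMeasure Q] {P : Measure Ω} [IsProbabilityMeasure P]
  {σ : ℕ → Ω' → ℕ} {τ : ℕ → Ω → ℕ} {φ : ℝ → ℝ}

theorem slowTail_of_interarrival (hσ : IsRecurrentRenewal Q σ) (hφ : SlowlyVarying φ)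
    (hs : ∀ n : ℕ, 1 ≤ n → interarrival Q σ n = φ n / n) :
    SlowTail (interarrival Q σ) (interarrivalTail Q σ) where
  nonneg _ := measureReal_nonneg
  tail_nonneg _ := measureReal_nonneg
  sub n := measureReal_tail_sub (hσ.measurable 1) n
  tendsto := tendsto_measureReal_tail (hσ.measurable 1)
  slow := by
    refine hφ.unifSlow.congr' ?_
    filter_upwards [eventually_ge_atTop 1] with n hn
    have : (n : ℝ) ≠ 0 := by exact_mod_cast (by omega : n ≠ 0)
    rw [hs n hn]
    field_simp

theorem lazyDouble_of_mixture (hσ : IsRecurrentRenewal Q σ) (hφ : SlowlyVarying φ)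
    (hs : ∀ n : ℕ, 1 ≤ n → interarrival Q σ n = φ n / n) (hτ : IsRecurrentRenewal P τ)
    (hmix : ∀ n : ℕ, P.real {ω | τ 1 ω = n} =
      (1 / 2) * (if n = 1 then 1 else 0) + (1 / 2) * Q.real {ω | 2 * σ 1 ω = n}) :
    LazyDouble (interarrival Q σ) (interarrivalTail Q σ) (fun n => Q.real {ω | 2 * σ 1 ω = n})
      (interarrival P τ) (interarrivalTail P τ) (renewalMass P τ) where
  tail := slowTail_of_interarrival hσ hφ hs
  renewal := hτ.renewalSeq
  g_nonneg _ := measureReal_nonneg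
  psum_g_le n := by
    rw [psum_measureReal ((hσ.measurable 1).const_mul 2)]
    linarith [measureReal_nonneg (μ := Q) (s := {ω | n < 2 * σ 1 ω})]
  g_even m := by
    rw [interarrival]
    congr 1
    ext ω
    simp
  g_odd n hn := by
    have : {ω | 2 * σ 1 ω = n} = ∅ := by
      ext ω
      simp only [Set.mem_ofPred_eq, Set.mem_empty_iff_false, iff_false]
      intro hω
      exact hn ⟨σ 1 ω, by omega⟩
    rw [this, measureReal_empty]
  f_eq := hmix
  r_eq n hn := by
    have h1 := psum_measureReal (P := P) (hτ.measurable 1) n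
    have h2 := psum_measureReal (P := Q) ((hσ.measurable 1).const_mul 2) n
    have h3 : psum (fun k => P.real {ω | τ 1 ω = k}) n =
        1 / 2 + 1 / 2 * psum (fun n => Q.real {ω | 2 * σ 1 ω = n}) n := by
      simp only [psum, hmix]
      rw [Finset.sum_add_distrib, ← Finset.mul_sum, ← Finset.mul_sum, Finset.sum_ite_eq',
        if_pos (Finset.mem_range.2 (by omega))]
      ring
    have h4 : {ω | n < 2 * σ 1 ω} = {ω | n / 2 < σ 1 ω} := by
      ext ω
      simp only [Set.mem_ofPred_eq]
      omega
    rw [h4] at h2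
    rw [h3, h2] at h1
    rw [interarrivalTail, interarrivalTail]
    linarith

theorem mixture_asymptotics (hσ : IsRecurrentRenewal Q σ) (hφ : SlowlyVarying φ)
    (hs : ∀ n : ℕ, 1 ≤ n → interarrival Q σ n = φ n / n) (hτ : IsRecurrentRenewal P τ)
    (hmix : ∀ n : ℕ, P.real {ω | τ 1 ω = n} =
      (1 / 2) * (if n = 1 then 1 else 0) + (1 / 2) * Q.real {ω | 2 * σ 1 ω = n}) :
    Asymptotics.IsEquivalent atTop (interarrivalTail P τ)
        (fun n : ℕ => (1 / 2) * interarrivalTail Q σ n) ∧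
      ¬ SeqRegularlyVarying (interarrival P τ) ∧
      Asymptotics.IsEquivalent atTop (renewalMass P τ)
        (fun n : ℕ => φ n / (2 * interarrivalTail P τ n ^ 2 * n)) ∧
      Asymptotics.IsEquivalent atTop (renewalMass P τ)
        (fun n : ℕ => interarrival P τ (2 * (n / 2)) / (2 * interarrivalTail P τ n ^ 2)) ∧
      SeqRegularlyVaryingWithIndex (renewalMass P τ) (-1) ∧
      SeqSlowlyVarying (renewalFunction P τ) ∧
      ¬ ReverseRenewalAsymptotics P τ := by
  have h := lazyDouble_of_mixture hσ hφ hs hτ hmix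
  set s := interarrival Q σ
  set f := interarrival P τ
  set r := interarrivalTail P τ
  set u := renewalMass P τ
  -- These zeros refute both regular variation of the gap law and the reverse asymptotics.
  have hfodd : ∀ m, f (2 * m + 3) = 0 := fun m => by
    rw [h.f_eq, if_neg (by omega), h.g_odd _ (by rw [Nat.not_even_iff_odd]; exact ⟨m + 1, by ring⟩)]
    ring
  have hodd : Tendsto (fun m : ℕ => 2 * m + 3) atTop atTop :=
    tendsto_atTop_mono (fun m => by simp only [id]; omega) tendsto_id
  have hφs : ∀ n : ℕ, 1 ≤ n → n * s n = φ n := fun n hn => by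
    have : (n : ℝ) ≠ 0 := by exact_mod_cast (by omega : n ≠ 0)
    rw [hs n hn]
    field_simp
  have hφpos : ∀ n : ℕ, 1 ≤ n → 0 < φ n := fun n hn => hφ.pos _ (by exact_mod_cast hn)
  have hlim : Tendsto (fun n : ℕ => u n / (φ n / (2 * r n ^ 2 * n))) atTop (𝓝 1) := by
    have h1 := h.tendsto_mul_u_div.const_mul 2
    rw [mul_one_div, div_self two_ne_zero] at h1
    refine h1.congr' ?_
    filter_upwards [eventually_ge_atTop 1] with n hn
    have hn0 : (n : ℝ) ≠ 0 := by exact_mod_cast (by omega : n ≠ 0)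
    have := h.r_pos n
    have := hφpos n hn
    rw [hφs n hn]
    field_simp
  have hu0 : ∀ᶠ n in atTop, u n ≠ 0 := by
    filter_upwards [hlim.eventually (lt_mem_nhds one_pos)] with n h1 h2
    simp [h2] at h1
  refine ⟨?_, ?_, ?_, ?_, ?_, ?_, ?_⟩
  · refine (Asymptotics.isEquivalent_iff_tendsto_one (Eventually.of_forall fun n => ?_)).2
      h.tendsto_tail_div
    have := h.tail.tail_pos n
    positivity
  · rintro ⟨ρ, L, hL, hev⟩
    obtain ⟨m, hm⟩ := (hodd.eventually hev).exists
    rw [hfodd] at hm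
    have hm0 : (0 : ℝ) < ((2 * m + 3 : ℕ) : ℝ) := by positivity
    exact (mul_pos (hL.pos _ hm0) (Real.rpow_pos_of_pos hm0 ρ)).ne hm
  · refine (Asymptotics.isEquivalent_iff_tendsto_one ?_).2 hlim
    filter_upwards [eventually_ge_atTop 1] with n hn
    have hn0 : (0 : ℝ) < n := by exact_mod_cast hn
    have := h.r_pos n
    have := hφpos n hn
    positivity
  · have hf2 : ∀ n, 2 ≤ n → f (2 * (n / 2)) = 1 / 2 * s (n / 2) := fun n hn => by
      rw [h.f_eq, if_neg (by omega), h.g_even]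
      ring
    have hs0 : ∀ n, 2 ≤ n → 0 < s (n / 2) := fun n hn => by
      have h1 := hφs (n / 2) (by omega)
      have h2 := hφpos (n / 2) (by omega)
      rw [← h1] at h2
      exact pos_of_mul_pos_right h2 (Nat.cast_nonneg _)
    refine (Asymptotics.isEquivalent_iff_tendsto_one ?_).2 ?_
    · filter_upwards [eventually_ge_atTop 2] with n hn
      rw [hf2 n hn]
      have := hs0 n hn
      have := h.r_pos n
      positivity
    · have h1 := h.tail.slow.ratio 3 tendsto_id tendsto_div_two_atTop
        (by filter_upwards [eventually_ge_atTop 2] with n hn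
            simp only [id]; omega)
      have h2 : Tendsto (fun n : ℕ => ((n / 2 : ℕ) : ℝ) / (n / 2 : ℝ)) atTop (𝓝 1) := by
        have h3 := tendsto_inv_atTop_zero.comp (tendsto_natCast_atTop_atTop (R := ℝ))
        have h4 : Tendsto (fun n : ℕ => 1 - 2 * ((n : ℝ))⁻¹) atTop (𝓝 1) := by
          simpa using (h3.const_mul 2).const_sub 1
        refine tendsto_of_tendsto_of_tendsto_of_le_of_le' h4 tendsto_const_nhds ?_ ?_
        · filter_upwards [eventually_ge_atTop 1] with n hn
          have hn0 : (0 : ℝ) < n := by exact_mod_cast hn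
          have h5 : (n : ℝ) ≤ 2 * ((n / 2 : ℕ) : ℝ) + 1 := by exact_mod_cast (by omega)
          rw [le_div_iff₀ (by positivity)]
          have h6 : (1 - 2 * (n : ℝ)⁻¹) * (n / 2) = n / 2 - 1 := by field_simp
          rw [h6]
          linarith
        · filter_upwards [eventually_ge_atTop 1] with n hn
          have hn0 : (0 : ℝ) < n := by exact_mod_cast hn
          rw [div_le_one (by positivity)]
          exact Nat.cast_div_le
      have h3 := (hlim.mul h1).mul h2
      simp only [mul_one] at h3
      refine h3.congr' ?_
      filter_upwards [eventually_ge_atTop 2] with n hn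
      have hn0 : (n : ℝ) ≠ 0 := by exact_mod_cast (by omega : n ≠ 0)
      have hn2 : ((n / 2 : ℕ) : ℝ) ≠ 0 := by exact_mod_cast (by omega : n / 2 ≠ 0)
      have := h.r_pos n
      have := hφpos n (by omega)
      have := hs0 n hn
      simp only [id, Pi.div_apply, hf2 n hn, hφs n (by omega)]
      field_simp
  · refine UnifSlow.seqRegularlyVaryingWithIndex_neg_one ?_
    refine ((UnifSlow.const (c := 1 / 2) (by norm_num)).mul h.unifSlow_limit).congr ?_
    have h1 := h.tendsto_mul_u_div.const_mul 2
    rw [mul_one_div, div_self two_ne_zero] at h1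
    refine h1.congr fun n => ?_
    rw [div_mul_eq_div_div_swap]
    ring
  · exact h.unifSlow_psum.seqSlowlyVarying
  · intro hrev
    obtain ⟨c, hc, h1⟩ := hrev.symm.exists_eq_mul
    obtain ⟨m, hm1, hm2⟩ := ((hodd.eventually h1).and (hodd.eventually hu0)).exists
    simp only [Pi.mul_apply] at hm1
    have h2 : interarrival P τ (2 * m + 3) = 0 := hfodd m
    rw [h2, mul_zero] at hm1
    exact mul_ne_zero (pow_ne_zero 2 (h.r_pos _).ne') hm2 hm1

end Mixture

/-! ### Existence of an instance. -/

/-- Every law on the positive integers is the gap law of a recurrent renewal process. -/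
theorem exists_isRecurrentRenewal (μ : Measure ℕ) [IsProbabilityMeasure μ] (h0 : μ {0} = 0) :
    ∃ τ : ℕ → (ℕ → ℕ) → ℕ, IsRecurrentRenewal (Measure.infinitePi fun _ : ℕ => μ) τ ∧
      ∀ A, (Measure.infinitePi fun _ : ℕ => μ).real {ω | τ 1 ω ∈ A} = μ.real A := by
  set P := Measure.infinitePi fun _ : ℕ => μ with hP
  have hmp : ∀ k, MeasurePreserving (Function.eval k) P μ := fun k =>
    measurePreserving_eval_infinitePi (fun _ : ℕ => μ) k
  have hgap : ∀ k, (fun ω : ℕ → ℕ => ∑ i ∈ Finset.range (k + 1), ω i - ∑ i ∈ Finset.range k, ω i) =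
      fun ω => ω k := fun k => by
    ext ω
    rw [Finset.sum_range_succ, Nat.add_sub_cancel_left]
  refine ⟨fun k ω => ∑ i ∈ Finset.range k, ω i, ⟨?_, ?_, ?_, ?_, ?_⟩, ?_⟩
  · intro k
    fun_prop
  · simp
  · have hpos : ∀ᵐ ω ∂P, ∀ k, ω k ≠ 0 := by
      rw [ae_all_iff]
      intro k
      have h1 : ∀ᵐ n ∂μ, n ≠ 0 := by
        rw [ae_iff]
        simpa using h0
      exact (hmp k).quasiMeasurePreserving.ae h1
    filter_upwards [hpos] with ω hω
    refine strictMono_nat_of_lt_succ fun k => ?_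
    rw [Finset.sum_range_succ]
    exact Nat.lt_add_of_pos_right (Nat.pos_of_ne_zero (hω k))
  · have h1 : iIndepFun (fun (k : ℕ) (ω : ℕ → ℕ) => ω k) P :=
      iIndepFun_infinitePi (X := fun _ n => n) fun _ => measurable_id
    rwa [← funext hgap] at h1
  · intro k
    simp only [hgap, Finset.sum_range_one]
    exact ⟨(hmp k).measurable.aemeasurable, (hmp 0).measurable.aemeasurable,
      (hmp k).map_eq.trans (hmp 0).map_eq.symm⟩
  · intro A
    simp only [Finset.sum_range_one]
    exact (hmp 0).measureReal_preimage (MeasurableSet.of_discrete.nullMeasurableSet)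

theorem exists_measure_of_hasSum {a : ℕ → ℝ} (ha : ∀ n, 0 ≤ a n) (hsum : HasSum a 1) :
    ∃ μ : Measure ℕ, IsProbabilityMeasure μ ∧ ∀ n, μ.real {n} = a n := by
  have h1 : HasSum (fun n => ENNReal.ofReal (a n)) 1 := by
    rw [← ENNReal.ofReal_one, ← hsum.tsum_eq, ENNReal.ofReal_tsum_of_nonneg ha hsum.summable]
    exact ENNReal.summable.hasSum
  let p : PMF ℕ := ⟨fun n => ENNReal.ofReal (a n), h1⟩
  refine ⟨p.toMeasure, inferInstance, fun n => ?_⟩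
  rw [measureReal_def, PMF.toMeasure_apply_singleton _ _ (measurableSet_singleton n)]
  exact ENNReal.toReal_ofReal (ha n)

/-- The function `x ↦ 1 + log x`. -/
noncomputable def onePlusLog (x : ℝ) : ℝ := 1 + Real.log x

theorem onePlusLog_pos {x : ℝ} (hx : 1 ≤ x) : 0 < onePlusLog x := by
  have := Real.log_nonneg hx
  unfold onePlusLog
  linarith

theorem tendsto_onePlusLog : Tendsto onePlusLog atTop atTop :=
  tendsto_atTop_add_const_left _ _ Real.tendsto_log_atTop

theorem measurable_onePlusLog : Measurable onePlusLog :=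
  Real.measurable_log.const_add 1

/-- A slowly varying function such that `n ↦ exampleFun n / n` telescopes. -/
noncomputable def exampleFun (x : ℝ) : ℝ :=
  onePlusLog 2 * (x * (onePlusLog (2 + x) - onePlusLog (1 + x))) /
    (onePlusLog (1 + x) * onePlusLog (2 + x))

/-- The numerator minus the denominator is log((a + c x)/(a + x)) → log c, while the denominator
diverges. -/
theorem tendsto_onePlusLog_ratio {a c : ℝ} (hc : 0 < c) :
    Tendsto (fun x => onePlusLog (a + c * x) / onePlusLog (a + x)) atTop (𝓝 1) := by
  have hax : Tendsto (fun x : ℝ => a + x) atTop atTop :=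
    tendsto_atTop_add_const_left _ _ tendsto_id
  have hacx : Tendsto (fun x : ℝ => a + c * x) atTop atTop :=
    tendsto_atTop_add_const_left _ _ (tendsto_id.const_mul_atTop hc)
  have h1 : Tendsto (fun x : ℝ => (a + c * x) / (a + x)) atTop (𝓝 c) := by
    have h2 := ((tendsto_inv_atTop_zero.comp hax).const_mul (a - c * a)).add_const c
    rw [mul_zero, zero_add] at h2
    refine h2.congr' ?_
    filter_upwards [hax.eventually_gt_atTop 0] with x hx
    simp only [Function.comp]
    field_simp
    ring
  have h3 := ((h1.log hc.ne').mul
    (tendsto_inv_atTop_zero.comp (tendsto_onePlusLog.comp hax))).const_add 1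
  rw [mul_zero, add_zero] at h3
  refine h3.congr' ?_
  filter_upwards [hax.eventually_gt_atTop 0, hacx.eventually_gt_atTop 0,
    (tendsto_onePlusLog.comp hax).eventually_gt_atTop 0] with x hx1 hx2 hx3
  simp only [Function.comp] at hx3 ⊢
  rw [Real.log_div hx2.ne' hx1.ne']
  field_simp
  simp only [onePlusLog]
  ring

/-- With y = 1 + x the expression is y log(1 + 1/y) - log(1 + 1/y). -/
theorem tendsto_mul_log_sub :
    Tendsto (fun x => x * (onePlusLog (2 + x) - onePlusLog (1 + x))) atTop (𝓝 1) := by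
  have hax : Tendsto (fun x : ℝ => 1 + x) atTop atTop :=
    tendsto_atTop_add_const_left _ _ tendsto_id
  have h1 := (Real.tendsto_mul_log_one_add_div_atTop 1).comp hax
  have h2 : Tendsto (fun x : ℝ => Real.log (1 + 1 / (1 + x))) atTop (𝓝 0) := by
    have h3 := ((tendsto_inv_atTop_zero.comp hax).const_add 1).log (by norm_num)
    simpa [Function.comp_def] using h3
  have h4 := h1.sub h2
  rw [sub_zero] at h4
  refine h4.congr' ?_
  filter_upwards [eventually_gt_atTop 0] with x hx
  have h5 : 1 + 1 / (1 + x) = (2 + x) / (1 + x) := by field_simp; ring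
  simp only [Function.comp, onePlusLog, h5]
  rw [Real.log_div (by positivity) (by positivity)]
  ring

theorem slowlyVarying_exampleFun : SlowlyVarying exampleFun where
  measurable := by
    have h1 := measurable_onePlusLog.comp (measurable_const_add (1 : ℝ))
    have h2 := measurable_onePlusLog.comp (measurable_const_add (2 : ℝ))
    exact (measurable_const.mul (measurable_id.mul (h2.sub h1))).div (h1.mul h2)
  pos x hx := by
    have h1 := onePlusLog_pos (x := 1 + x) (by linarith)
    have h2 := onePlusLog_pos (x := 2 + x) (by linarith)
    have h3 := onePlusLog_pos (x := 2) (by norm_num)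
    have h4 : 0 < onePlusLog (2 + x) - onePlusLog (1 + x) := by
      have := Real.log_lt_log (show 0 < 1 + x by linarith) (show 1 + x < 2 + x by linarith)
      simp only [onePlusLog]
      linarith
    unfold exampleFun
    positivity
  tendsto c hc := by
    have hcx : Tendsto (fun x : ℝ => c * x) atTop atTop := tendsto_id.const_mul_atTop hc
    have h1 := ((tendsto_mul_log_sub.comp hcx).div tendsto_mul_log_sub one_ne_zero).mul
      (((tendsto_onePlusLog_ratio (a := 1) hc).mul
        (tendsto_onePlusLog_ratio (a := 2) hc)).inv₀ (by norm_num))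
    simp only [mul_one, div_one, inv_one] at h1
    refine h1.congr fun x => ?_
    have h3 := (onePlusLog_pos (x := 2) (by norm_num)).ne'
    have key : ∀ k A' A a' a b' b : ℝ, k ≠ 0 →
        A' / A * (a' / a * (b' / b))⁻¹ = k * A' / (a' * b') / (k * A / (a * b)) := by
      intro k A' A a' a b' b hk
      rw [mul_div_assoc k A', mul_div_assoc k A, mul_div_mul_left _ _ hk, div_div_div_eq, mul_inv,
        inv_div, inv_div]
      ring
    exact key _ _ _ _ _ _ _ h3

theorem exampleFun_div {n : ℕ} (hn : 1 ≤ n) : exampleFun n / n =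
    onePlusLog 2 * (onePlusLog (1 + n))⁻¹ - onePlusLog 2 * (onePlusLog (2 + n))⁻¹ := by
  have hn0 : (0 : ℝ) < n := by exact_mod_cast hn
  have h1 := (onePlusLog_pos (x := 1 + n) (by linarith)).ne'
  have h2 := (onePlusLog_pos (x := 2 + n) (by linarith)).ne'
  unfold exampleFun
  field_simp

theorem hasSum_exampleFun : HasSum (fun n : ℕ => if n = 0 then 0 else exampleFun n / n) 1 := by
  rw [hasSum_iff_tendsto_nat_of_nonneg]
  · rw [← tendsto_add_atTop_iff_nat 1]
    have h0 := (onePlusLog_pos (x := 2) (by norm_num)).ne'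
    -- The factor `onePlusLog 2` normalises the telescoping sum, whose first term, at i = 1, starts
    -- from 1 / `onePlusLog 2`.
    have h1 : ∀ n : ℕ, ∑ i ∈ Finset.range (n + 1),
        (if i = 0 then 0 else exampleFun i / i) =
        1 - onePlusLog 2 * (onePlusLog (2 + n))⁻¹ := by
      intro n
      induction n with
      | zero => simp [h0]
      | succ n ih =>
        rw [Finset.sum_range_succ, ih, if_neg (by omega), exampleFun_div (by omega)]
        push_cast
        rw [show (1 : ℝ) + (n + 1) = 2 + n by ring]
        ring
    simp only [h1]
    have h2 : Tendsto (fun n : ℕ => (2 : ℝ) + n) atTop atTop :=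
      tendsto_atTop_add_const_left _ _ tendsto_natCast_atTop_atTop
    simpa using ((tendsto_inv_atTop_zero.comp (tendsto_onePlusLog.comp h2)).const_mul
      (onePlusLog 2)).const_sub 1
  · intro n
    split_ifs with hn
    · exact le_rfl
    · have hn0 : (0 : ℝ) < n := by exact_mod_cast Nat.pos_of_ne_zero hn
      exact (div_pos (slowlyVarying_exampleFun.pos n hn0) hn0).le

/-- A pair of renewal processes as in the example. -/
theorem exists_mixture : ∃ (P Q : Measure (ℕ → ℕ)) (σ τ : ℕ → (ℕ → ℕ) → ℕ),
    IsProbabilityMeasure P ∧ IsProbabilityMeasure Q ∧ IsRecurrentRenewal Q σ ∧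
    (∀ n : ℕ, 1 ≤ n → interarrival Q σ n = exampleFun n / n) ∧ IsRecurrentRenewal P τ ∧
    ∀ n : ℕ, P.real {ω | τ 1 ω = n} =
      (1 / 2) * (if n = 1 then 1 else 0) + (1 / 2) * Q.real {ω | 2 * σ 1 ω = n} := by
  obtain ⟨μ, hμ, hμa⟩ := exists_measure_of_hasSum (fun n => by
    split_ifs with hn
    · exact le_rfl
    · have hn0 : (0 : ℝ) < n := by exact_mod_cast Nat.pos_of_ne_zero hn
      exact (div_pos (slowlyVarying_exampleFun.pos n hn0) hn0).le) hasSum_exampleFun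
  have hμ0 : μ {0} = 0 := by
    rw [← measureReal_eq_zero_iff, hμa, if_pos rfl]
  set ν : Measure ℕ := (2⁻¹ : ENNReal) • Measure.dirac 1 + (2⁻¹ : ENNReal) • μ.map (2 * ·) with hν
  have hm : Measurable fun n : ℕ => 2 * n := measurable_id.const_mul 2
  have : IsProbabilityMeasure (μ.map (2 * ·)) := Measure.isProbabilityMeasure_map hm.aemeasurable
  have hνp : IsProbabilityMeasure ν := ⟨by simp [hν, ENNReal.inv_two_add_inv_two]⟩
  have hνs : ∀ n, ν.real {n} =
      (1 / 2) * (if n = 1 then 1 else 0) + (1 / 2) * μ.real {m | 2 * m = n} := by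
    intro n
    have h1 : ν.real {n} = (1 / 2) * (Measure.dirac 1).real {n} +
        (1 / 2) * (μ.map (2 * ·)).real {n} := by
      have hfin : ∀ κ : Measure ℕ, IsProbabilityMeasure κ →
          ((2⁻¹ : ENNReal) • κ) {n} ≠ ⊤ := fun κ _ => by
        rw [Measure.smul_apply, smul_eq_mul]
        exact ENNReal.mul_ne_top (by simp) (measure_ne_top _ _)
      rw [hν, measureReal_add_apply (hfin _ inferInstance) (hfin _ inferInstance),
        measureReal_ennreal_smul_apply, measureReal_ennreal_smul_apply]
      simp
    rw [h1, map_measureReal_apply hm (measurableSet_singleton n)]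
    congr 2
    rw [measureReal_def, Measure.dirac_apply' _ (measurableSet_singleton n)]
    by_cases hn : n = 1
    · simp [hn]
    · simp [hn, Ne.symm hn]
  have hν0 : ν {0} = 0 := by
    rw [← measureReal_eq_zero_iff, hνs, if_neg (by norm_num)]
    have : {m : ℕ | 2 * m = 0} = {0} := by ext m; simp
    rw [this, hμa, if_pos rfl]
    norm_num
  obtain ⟨σ, hσ, hσ1⟩ := exists_isRecurrentRenewal μ hμ0
  obtain ⟨τ, hτ, hτ1⟩ := exists_isRecurrentRenewal ν hν0
  refine ⟨_, _, σ, τ, inferInstance, inferInstance, hσ, fun n hn => ?_, hτ, fun n => ?_⟩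
  · have := hσ1 {n}
    rw [hμa, if_neg (by omega)] at this
    exact this
  · have h1 := hτ1 {n}
    rw [hνs, ← hσ1] at h1
    exact h1

theorem mainTheorem6 :
    -- the example, for every admissible `σ`
    (∀ (Ω Ω' : Type*) [MeasurableSpace Ω] [MeasurableSpace Ω']
        (Q : Measure Ω') [IsProbabilityMeasure Q] (P : Measure Ω) [IsProbabilityMeasure P]
        (σ : ℕ → Ω' → ℕ) (τ : ℕ → Ω → ℕ) (φ : ℝ → ℝ),
        IsRecurrentRenewal Q σ →
        SlowlyVarying φ →
        (∀ n : ℕ, 1 ≤ n → interarrival Q σ n = φ n / n) →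
        IsRecurrentRenewal P τ →
        -- `τ 1` is `1` or `2 σ 1`, with probability `1/2` each
        (∀ n : ℕ, P.real {ω | τ 1 ω = n} =
          (1 / 2) * (if n = 1 then 1 else 0) + (1 / 2) * Q.real {ω | 2 * σ 1 ω = n}) →
        Asymptotics.IsEquivalent atTop (interarrivalTail P τ)
            (fun n : ℕ => (1 / 2) * interarrivalTail Q σ n) ∧
          ¬ SeqRegularlyVarying (interarrival P τ) ∧
          Asymptotics.IsEquivalent atTop (renewalMass P τ)
            (fun n : ℕ => φ n / (2 * interarrivalTail P τ n ^ 2 * n)) ∧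
          Asymptotics.IsEquivalent atTop (renewalMass P τ)
            (fun n : ℕ => interarrival P τ (2 * (n / 2)) / (2 * interarrivalTail P τ n ^ 2)) ∧
          SeqRegularlyVaryingWithIndex (renewalMass P τ) (-1) ∧
          SeqSlowlyVarying (renewalFunction P τ) ∧
          ¬ ReverseRenewalAsymptotics P τ) ∧
    -- the unaveraged reverse renewal statement is false in general
    ¬ (∀ (Ω : Type) [MeasurableSpace Ω] (P : Measure Ω) [IsProbabilityMeasure P]
        (τ : ℕ → Ω → ℕ),
        IsRecurrentRenewal P τ →
        SeqRegularlyVarying (renewalMass P τ) →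
        SeqSlowlyVarying (renewalFunction P τ) →
        ReverseRenewalAsymptotics P τ) := by
  refine ⟨fun Ω Ω' _ _ Q _ P _ σ τ φ hσ hφ hs hτ hmix => mixture_asymptotics hσ hφ hs hτ hmix,
    fun hall => ?_⟩
  obtain ⟨P, Q, σ, τ, hP, hQ, hσ, hs, hτ, hmix⟩ := exists_mixture
  obtain ⟨-, -, -, -, hu, hU, hnot⟩ :=
    mixture_asymptotics hσ slowlyVarying_exampleFun hs hτ hmix
  exact hnot (hall _ P τ hτ ⟨-1, hu⟩ hU)
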